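/- **Notation.** For $\tau\in\mathbb H=\{\operatorname{Im}\tau>0\}$ let $\Lambda_\tau=\mathbb Z+\mathbb Z\tau$, $\omega_0=0$, $\omega_1=1$, $\omega_2=\tau$, $\omega_3=1+\tau$. Let $\wp(z|\tau)$ and $\zeta(z|\tau)$ be the Weierstrass functions of $\Lambda_\tau$, $\wp'=\partial_z\wp$, $\eta_1(\tau)=\zeta(z+1|\tau)-\zeta(z|\tau)$ and $e_j(\tau)=\wp(\omega_j/2|\tau)$. Let $n_0,n_1,n_2,n_3\in\mathbb C$ with $n_k\notin\frac12+\mathbb Z$ for all $k$. The Hamiltonian system is $$\frac{dp}{d\tau}=\frac{-i}{4\pi}\bigl(2A-\zeta(2p|\tau)+2p\,\eta_1(\tau)\bigr),$$ $$\frac{dA}{d\tau}=\frac{i}{4\pi}\Bigl(\bigl(2\wp(2p|\tau)+2\eta_1(\tau)\bigr)A-\tfrac32\wp'(2p|\tau)-\sum_{k=0}^3n_k(n_k+1)\wp'\bigl(p+\tfrac{\omega_k}2\big|\tau\bigr)\Bigr),$$ and the generalized Lamé equation is $y''(z)=I(z;\tau)\,y(z)$ with $$I(z;\tau)=\sum_{k=0}^3n_k(n_k+1)\wp\bigl(z+\tfrac{\omega_k}2\big|\tau\bigr)+\tfrac34\bigl(\wp(z+p|\tau)+\wp(z-p|\tau)\bigr)+A\bigl(\zeta(z+p|\tau)-\zeta(z-p|\tau)\bigr)+B,$$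 $$B=A^2-\zeta(2p|\tau)A-\tfrac34\wp(2p|\tau)-\sum_{k=0}^3n_k(n_k+1)\wp\bigl(p+\tfrac{\omega_k}2\big|\tau\bigr).$$ **Theorem.** Let $\tau_0\in\mathbb H$, and let $U\subset\mathbb H$ be open and connected, with $\tau_0+t(\tau-\tau_0)\in U$ for all $\tau\in U$ and $0<t\le1$ (for example a disc around $\tau_0$ cut along a radius). Let $(p(\tau),A(\tau))$ be a holomorphic solution of the Hamiltonian system on $U$, with $2p(\tau)\notin\Lambda_\tau$ there, such that $p(\tau_0)=0$ in the sense that $p(\tau)\to0$ as $\tau\to\tau_0$ in $U$. Then there are a holomorphic branch of $(\tau-\tau_0)^{1/2}$ on $U$ and constants $c_0,\tilde h\in\mathbb C$ such that $$p(\tau)=c_0(\tau-\tau_0)^{1/2}\bigl(1+\tilde h(\tau-\tau_0)+O((\tau-\tau_0)^2)\bigr)\quad\text{as }\tau\to\tau_0\text{ in }U,$$ and either $c_0^2=i\frac{n_0+1/2}{\pi}$ or $c_0^2=-i\frac{n_0+1/2}{\pi}$. Put $m=n_0+1$ in the first case, $m=n_0-1$ in the second, and $$B_0=2\pi i\,c_0^2\bigl(4\pi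 i\,\tilde h-\eta_1(\tau_0)\bigr)-\sum_{j=1}^3n_j(n_j+1)e_j(\tau_0).$$ Then, as $\tau\to\tau_0$ in $U$, the generalized Lamé equation converges to $$y''=\Bigl[\sum_{j=1}^3n_j(n_j+1)\wp\bigl(z+\tfrac{\omega_j}2\big|\tau_0\bigr)+m(m+1)\wp(z|\tau_0)+B_0\Bigr]y ,$$ that is, with $\omega_j=\omega_j(\tau_0)$, the potentials $I(z;\tau)$ converge to the bracket locally uniformly in $z$ on the complement of $\Lambda_{\tau_0}\cup\bigcup\bigl\{\tfrac{\omega_j}2+\Lambda_{\tau_0}:1\le j\le3,\ n_j(n_j+1)\ne0\bigr\}$. -/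

import Mathlib

open Filter Topology Asymptotics

noncomputable section

/-- The period pair `(1, τ)`, whose lattice is `Λ_τ = ℤ + ℤ τ`. -/
def tauPair (τ : UpperHalfPlane) : PeriodPair where
  ω₁ := 1
  ω₂ := τ
  indep := by
    rw [LinearIndependent.pair_iff]
    intro a b h
    have him := congrArg Complex.im h
    have hre := congrArg Complex.re h
    simp at him hre
    have hb : b = 0 := him.resolve_right τ.im_pos.ne'
    subst hb
    exact ⟨by simpa using hre, rfl⟩

/-- The lattice `Λ_τ = ℤ + ℤ τ`, for `τ` in the upper half plane. Like the elliptic functions below,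
it takes a complex argument `τ` and is only meant for `0 < τ.im`. -/
def tauLattice (τ : ℂ) : Set ℂ := (tauPair (UpperHalfPlane.ofComplex τ)).lattice

/-- The Weierstrass function `℘(z | τ)`. -/
def wp (τ z : ℂ) : ℂ := (tauPair (UpperHalfPlane.ofComplex τ)).weierstrassP z

/-- Its derivative `℘'(z | τ)` with respect to `z`. -/
def wpDeriv (τ z : ℂ) : ℂ := (tauPair (UpperHalfPlane.ofComplex τ)).derivWeierstrassP z

/-- The Weierstrass zeta function of a lattice,
`ζ(z) = 1 / z + ∑_{l ≠ 0} (1 / (z - l) + 1 / l + z / l ^ 2)`.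
The summand at `l = 0` is `1 / z`, because `1 / 0 = 0` and `z / 0 = 0`. -/
def PeriodPair.weierstrassZeta (L : PeriodPair) (z : ℂ) : ℂ :=
  ∑' l : L.lattice, (1 / (z - l) + 1 / (l : ℂ) + z / (l : ℂ) ^ 2)

/-- The Weierstrass zeta function `ζ(z | τ)`. -/
def wzeta (τ z : ℂ) : ℂ := (tauPair (UpperHalfPlane.ofComplex τ)).weierstrassZeta z

/-- The quasi-period `η₁(τ)`, that is, the constant `ζ(z + 1 | τ) - ζ(z | τ)`, taken at
`z = -1/2`. -/
def eta1 (τ : ℂ) : ℂ := wzeta τ (1 / 2) - wzeta τ (-1 / 2)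

/-- The periods `ω₀ = 0`, `ω₁ = 1`, `ω₂ = τ`, `ω₃ = 1 + τ`. -/
def omega (τ : ℂ) : Fin 4 → ℂ := ![0, 1, τ, 1 + τ]

/-- The value of `B` for which `± p` are apparent singularities of the generalized Lamé equation:
`B = A² - ζ(2p) A - (3/4) ℘(2p) - ∑ₖ nₖ (nₖ + 1) ℘(p + ωₖ/2)`. -/
def apparentB (n : Fin 4 → ℂ) (τ p A : ℂ) : ℂ :=
  A ^ 2 - wzeta τ (2 * p) * A - 3 / 4 * wp τ (2 * p)
    - ∑ k, n k * (n k + 1) * wp τ (p + omega τ k / 2)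

/-- The potential of the generalized Lamé equation `y'' = I(z) y`. -/
def genLamePotential (n : Fin 4 → ℂ) (τ p A B z : ℂ) : ℂ :=
  ∑ k, n k * (n k + 1) * wp τ (z + omega τ k / 2)
    + 3 / 4 * (wp τ (z + p) + wp τ (z - p))
    + A * (wzeta τ (z + p) - wzeta τ (z - p)) + B

/-- The potential
`∑_{j = 1}^{3} nⱼ (nⱼ + 1) ℘(z + ωⱼ/2) + m (m + 1) ℘(z) + B` of the limiting equation. -/
def limitPotential (n : Fin 4 → ℂ) (m B τ z : ℂ) : ℂ :=
  ∑ j : Fin 3, n j.succ * (n j.succ + 1) * wp τ (z + omega τ j.succ / 2)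
    + m * (m + 1) * wp τ z + B

/-- The lattice points, together with those translates of the half periods `ωⱼ/2`, `j = 1, 2, 3`,
whose coefficient `nⱼ (nⱼ + 1)` in the potential does not vanish. -/
def singularPoints (n : Fin 4 → ℂ) (τ : ℂ) : Set ℂ :=
  {z | z ∈ tauLattice τ ∨
    ∃ j : Fin 3, n j.succ * (n j.succ + 1) ≠ 0 ∧ z + omega τ j.succ / 2 ∈ tauLattice τ}

/-- `(p, A)` is a (holomorphic) solution on `U` of the Hamiltonian system
`dp/dτ = ∂K/∂A`, `dA/dτ = -∂K/∂p` with
`K = (-i/4π) (A² + (-ζ(2p) + 2 p η₁) A - (3/4) ℘(2p) - ∑ₖ nₖ (nₖ + 1) ℘(p + ωₖ/2))`.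
Its right-hand sides make sense only where `p(τ)` is not a 2-torsion point. -/
structure IsHamiltonianSolution (n : Fin 4 → ℂ) (p A : ℂ → ℂ) (U : Set ℂ) : Prop where
  two_mul_notMem : ∀ τ ∈ U, 2 * p τ ∉ tauLattice τ
  hasDerivAt_p : ∀ τ ∈ U, HasDerivAt p
    (-Complex.I / (4 * Real.pi) * (2 * A τ - wzeta τ (2 * p τ) + 2 * p τ * eta1 τ)) τ
  hasDerivAt_A : ∀ τ ∈ U, HasDerivAt A
    (Complex.I / (4 * Real.pi) *
      ((2 * wp τ (2 * p τ) + 2 * eta1 τ) * A τ - 3 / 2 * wpDeriv τ (2 * p τ)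
        - ∑ k, n k * (n k + 1) * wpDeriv τ (p τ + omega τ k / 2))) τ

/-- A domain on which single-valued branches near `τ₀` are considered: open, connected, contained
in the upper half plane, and containing with each point the half-open segment from it to `τ₀`
(for instance a disc around `τ₀` cut along a radius, or a sector with vertex `τ₀`). -/
structure IsBranchDomain (τ₀ : ℂ) (U : Set ℂ) : Prop where
  isOpen : IsOpen U
  isConnected : IsConnected U
  im_pos : ∀ τ ∈ U, 0 < τ.im
  segment_mem : ∀ τ ∈ U, ∀ t : ℝ, 0 < t → t ≤ 1 → τ₀ + t * (τ - τ₀) ∈ U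

end

/-! Put `q = p²`, `w = p A`, `ν = n₀ + 1/2`, `α = -i/(4π)`. Replacing ζ, ℘, ℘' by their principal
parts at the origin turns the Hamiltonian system into `q' = α(4w - 1 + 4qη₁ + O(q²))`, `w' = α(2H +
O(q(1 + |w|)))` with `H = ((w - 1/4)² - ν²)/q`. The quotient `H` looks singular, but in `H'` the
terms of order `H/q` cancel, and `|w - 1/4|² ≤ |ν|² + |q H|` bounds what remains: `|H'| ≤ C(1 +
|H|)`. Grönwall's inequality makes `H` bounded with a limit `H₀` at `τ₀`. Hence `w` tends to `1/4 +
L` with `L² = ν²`, and integrating the system repeatedly gives `q = 4αL(τ-τ₀) + (4α²H₀ +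
8α²η₁L)(τ-τ₀)² + O((τ-τ₀)³)`. This is `IsBranchDomain.exists_expansion`, applied in
`IsHamiltonianSolution.exists_expansion`.

Since `ν ≠ 0`, the leading coefficient `c₀² = 4αL` is nonzero, and `IsBranchDomain.exists_sqrt`
extracts a square root, giving `p` and `h`.

For the potential, the principal parts in `B` add up to exactly `H`, so `B` tends to `H₀` minus the
half-period terms. Also `A(ζ(z+p) - ζ(z-p))` behaves as `-2pA ℘(z)`, with limit `-2(1/4 + L)℘(z)`.
The coefficient of `℘(z)` becomes `n₀(n₀+1) + 1 - 2L`, which is `m(m+1)` with `m = n₀ ∓ 1` for `L =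
±ν`.

The elliptic estimates must be uniform in τ. They come from sums over the fixed index set `ℤ × ℤ`,
dominated by powers of a weight that depends on `τ₀` only. -/

/-- Grönwall's inequality along a segment, for `‖f'‖ ≤ C (1 + ‖f‖)`. -/
theorem one_add_norm_le_of_norm_deriv_le {f f' : ℂ → ℂ} {x y : ℂ} {C : ℝ} (hC : 0 < C)
    (h : ∀ t : ℝ, 0 ≤ t → t ≤ 1 → HasDerivAt f (f' (x + t * (y - x))) (x + t * (y - x)) ∧
      ‖f' (x + t * (y - x))‖ ≤ C * (1 + ‖f (x + t * (y - x))‖)) :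
    1 + ‖f y‖ ≤ (1 + ‖f x‖) * Real.exp (C * ‖y - x‖) := by
  rcases eq_or_ne x y with rfl | hxy
  · simp
  have hd : 0 < ‖y - x‖ := norm_pos_iff.mpr (sub_ne_zero.mpr hxy.symm)
  have hγ : ∀ t : ℝ, HasDerivAt (fun t : ℝ => x + (t : ℂ) * (y - x)) (y - x) t := fun t => by
    simpa using ((Complex.ofRealCLM.hasDerivAt (x := t)).mul_const (y - x)).const_add x
  have hg : ∀ t : ℝ, 0 ≤ t → t ≤ 1 → HasDerivAt (fun t : ℝ => f (x + (t : ℂ) * (y - x)))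
      (f' (x + t * (y - x)) * (y - x)) t := fun t h0 h1 =>
    (h t h0 h1).1.comp t (hγ t)
  have key := norm_le_gronwallBound_of_norm_deriv_right_le
    (f := fun t : ℝ => f (x + (t : ℂ) * (y - x)))
    (f' := fun t : ℝ => f' (x + t * (y - x)) * (y - x)) (δ := ‖f x‖) (K := C * ‖y - x‖)
    (ε := C * ‖y - x‖) (a := 0) (b := 1)
    (fun t ht => (hg t ht.1 ht.2).continuousAt.continuousWithinAt)
    (fun t ht => (hg t ht.1 ht.2.le).hasDerivWithinAt) (by simp)
    (fun t ht => by
      rw [norm_mul]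
      have := mul_le_mul_of_nonneg_right (h t ht.1 ht.2.le).2 hd.le
      linarith) 1 (by simp)
  rw [gronwallBound_of_K_ne_0 (by positivity), div_self (by positivity)] at key
  simp only [Complex.ofReal_one, one_mul, add_sub_cancel, sub_zero, mul_one] at key
  linarith

theorem norm_sub_le_of_norm_deriv_le_segment {f f' : ℂ → ℂ} {x y : ℂ} {C : ℝ}
    (h : ∀ t : ℝ, 0 ≤ t → t ≤ 1 → HasDerivAt f (f' (x + t * (y - x))) (x + t * (y - x)) ∧
      ‖f' (x + t * (y - x))‖ ≤ C) :
    ‖f y - f x‖ ≤ C * ‖y - x‖ := by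
  have hs : ∀ z ∈ segment ℝ x y, ∃ t : ℝ, 0 ≤ t ∧ t ≤ 1 ∧ z = x + t * (y - x) := by
    intro z hz
    rw [segment_eq_image'] at hz
    obtain ⟨t, ht, rfl⟩ := hz
    exact ⟨t, ht.1, ht.2, by simp⟩
  refine Convex.norm_image_sub_le_of_norm_hasDerivWithin_le (f' := f') (s := segment ℝ x y)
    ?_ ?_ (convex_segment x y) (left_mem_segment ℝ x y) (right_mem_segment ℝ x y)
  · intro z hz
    obtain ⟨t, h0, h1, rfl⟩ := hs z hz
    exact (h t h0 h1).1.hasDerivWithinAt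
  · intro z hz
    obtain ⟨t, h0, h1, rfl⟩ := hs z hz
    exact (h t h0 h1).2

/-! ### Limits and integration at the vertex of a branch domain -/

namespace IsBranchDomain

variable {τ₀ : ℂ} {U : Set ℂ}

theorem mem_ball (hU : IsBranchDomain τ₀ U) {ε : ℝ} {τ : ℂ} (hτ : τ ∈ U ∩ Metric.ball τ₀ ε)
    {t : ℝ} (h0 : 0 < t) (h1 : t ≤ 1) : τ₀ + t * (τ - τ₀) ∈ U ∩ Metric.ball τ₀ ε := by
  refine ⟨hU.segment_mem τ hτ.1 t h0 h1, ?_⟩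
  have := hτ.2
  rw [mem_ball_iff_norm] at this ⊢
  rw [add_sub_cancel_left, norm_mul, Complex.norm_real, Real.norm_of_nonneg h0.le]
  nlinarith [norm_nonneg (τ - τ₀)]

theorem isOpen_inter_ball (hU : IsBranchDomain τ₀ U) (ε : ℝ) : IsOpen (U ∩ Metric.ball τ₀ ε) :=
  hU.isOpen.inter Metric.isOpen_ball

theorem ray_mem (hU : IsBranchDomain τ₀ U) {ε : ℝ} {τ : ℂ} (hτ : τ ∈ U ∩ Metric.ball τ₀ ε)
    {r : ℝ} (h0 : 0 < r) (h1 : r ≤ 1) {t : ℝ} (ht0 : 0 ≤ t) (ht1 : t ≤ 1) :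
    (τ₀ + r * (τ - τ₀)) + t * (τ - (τ₀ + r * (τ - τ₀))) ∈ U ∩ Metric.ball τ₀ ε := by
  have := hU.mem_ball hτ (t := r + t * (1 - r)) (by nlinarith) (by nlinarith)
  convert this using 1
  push_cast
  ring

theorem ray_mem' (hU : IsBranchDomain τ₀ U) {ε : ℝ} {τ : ℂ} (hτ : τ ∈ U ∩ Metric.ball τ₀ ε)
    {r : ℝ} (h0 : 0 < r) (h1 : r ≤ 1) {t : ℝ} (ht0 : 0 ≤ t) (ht1 : t ≤ 1) :
    τ + t * ((τ₀ + r * (τ - τ₀)) - τ) ∈ U ∩ Metric.ball τ₀ ε := by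
  have := hU.ray_mem hτ h0 h1 (t := 1 - t) (by linarith) (by linarith)
  convert this using 1
  push_cast
  ring

theorem tendsto_ray (hU : IsBranchDomain τ₀ U) {τ : ℂ} (hτ : τ ∈ U) :
    Tendsto (fun t : ℝ => τ₀ + t * (τ - τ₀)) (𝓝[>] 0) (𝓝[U] τ₀) := by
  refine tendsto_nhdsWithin_iff.mpr ⟨?_, ?_⟩
  · have : Continuous (fun t : ℝ => τ₀ + t * (τ - τ₀)) := by fun_prop
    simpa using (this.tendsto 0).mono_left nhdsWithin_le_nhds
  · filter_upwards [Ioo_mem_nhdsGT (zero_lt_one (α := ℝ))] with t ht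
    exact hU.segment_mem τ hτ t ht.1 ht.2.le

theorem neBot (hU : IsBranchDomain τ₀ U) : (𝓝[U] τ₀).NeBot := by
  obtain ⟨τ, hτ⟩ := hU.isConnected.nonempty
  exact (hU.tendsto_ray hτ).neBot

/-- Integrating along the ray to the vertex gains one power of `‖τ - τ₀‖`: the mean value inequality
is applied between `τ` and a point of its ray, which then tends to `τ₀`. -/
theorem norm_sub_limit_le (hU : IsBranchDomain τ₀ U) {ε C : ℝ} {f f' : ℂ → ℂ} {L : ℂ} {k : ℕ}
    (hf : ∀ τ ∈ U ∩ Metric.ball τ₀ ε, HasDerivAt f (f' τ) τ ∧ ‖f' τ‖ ≤ C * ‖τ - τ₀‖ ^ k)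
    (hL : Tendsto f (𝓝[U] τ₀) (𝓝 L)) (hC : 0 ≤ C) {τ : ℂ} (hτ : τ ∈ U ∩ Metric.ball τ₀ ε) :
    ‖f τ - L‖ ≤ C * ‖τ - τ₀‖ ^ (k + 1) := by
  have h1 : Tendsto (fun t : ℝ => ‖f τ - f (τ₀ + t * (τ - τ₀))‖) (𝓝[>] 0) (𝓝 ‖f τ - L‖) :=
    (tendsto_const_nhds.sub (hL.comp (hU.tendsto_ray hτ.1))).norm
  refine le_of_tendsto h1 ?_
  filter_upwards [Ioo_mem_nhdsGT (zero_lt_one (α := ℝ))] with r hr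
  have := norm_sub_le_of_norm_deriv_le_segment (f := f) (f' := f') (x := τ₀ + r * (τ - τ₀))
    (y := τ) (C := C * ‖τ - τ₀‖ ^ k) (fun t h0 h1 => by
      have hm := hU.ray_mem hτ hr.1 hr.2.le h0 h1
      refine ⟨(hf _ hm).1, (hf _ hm).2.trans ?_⟩
      have : ((τ₀ + r * (τ - τ₀)) + t * (τ - (τ₀ + r * (τ - τ₀)))) - τ₀
        = ((r + t * (1 - r) : ℝ) : ℂ) * (τ - τ₀) := by push_cast; ring
      rw [this, norm_mul, Complex.norm_real, Real.norm_of_nonneg (by nlinarith [hr.1, hr.2])]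
      exact mul_le_mul_of_nonneg_left (pow_le_pow_left₀
        (mul_nonneg (by nlinarith [hr.1, hr.2]) (norm_nonneg _))
        (mul_le_of_le_one_left (norm_nonneg _) (by nlinarith [hr.1, hr.2])) k) hC)
  refine this.trans ?_
  have h2 : τ - (τ₀ + r * (τ - τ₀)) = ((1 - r : ℝ) : ℂ) * (τ - τ₀) := by push_cast; ring
  rw [h2, norm_mul, Complex.norm_real, Real.norm_of_nonneg (by linarith [hr.2]), pow_succ,
    ← mul_assoc C]
  exact mul_le_mul_of_nonneg_left
    (mul_le_of_le_one_left (norm_nonneg (τ - τ₀)) (show 1 - r ≤ 1 by linarith [hr.1])) (by positivity)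

/-- A holomorphic function with `‖f'‖ ≤ C (1 + ‖f‖)` near the vertex of a branch domain has a limit
at the vertex, and is bounded near it. -/
theorem exists_tendsto_of_norm_deriv_le (hU : IsBranchDomain τ₀ U) {ε C : ℝ} (hε : 0 < ε)
    (hC : 0 < C) {f f' : ℂ → ℂ}
    (hf : ∀ τ ∈ U ∩ Metric.ball τ₀ ε, HasDerivAt f (f' τ) τ ∧ ‖f' τ‖ ≤ C * (1 + ‖f τ‖)) :
    ∃ L : ℂ, ∃ M : ℝ, 0 ≤ M ∧ Tendsto f (𝓝[U] τ₀) (𝓝 L) ∧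
      ∀ τ ∈ U ∩ Metric.ball τ₀ ε, ‖f τ‖ ≤ M ∧ ‖f' τ‖ ≤ M ∧ ‖f τ - L‖ ≤ M * ‖τ - τ₀‖ := by
  have hV : U ∩ Metric.ball τ₀ ε ∈ 𝓝[U] τ₀ :=
    inter_mem self_mem_nhdsWithin (mem_nhdsWithin_of_mem_nhds (Metric.ball_mem_nhds τ₀ hε))
  have hdist : ∀ τ ∈ U ∩ Metric.ball τ₀ ε, ∀ r : ℝ, 0 < r → r ≤ 1 →
      ‖τ - (τ₀ + r * (τ - τ₀))‖ ≤ ‖τ - τ₀‖ := by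
    intro τ hτ r h0 h1
    have h2 : τ - (τ₀ + r * (τ - τ₀)) = ((1 - r : ℝ) : ℂ) * (τ - τ₀) := by push_cast; ring
    rw [h2, norm_mul, Complex.norm_real, Real.norm_of_nonneg (by linarith)]
    exact mul_le_of_le_one_left (norm_nonneg _) (by linarith)
  -- `hin` and `hout` are Grönwall along a ray in the two directions: values nearer the vertex are
  -- controlled by those farther out, and conversely.
  have hin : ∀ τ ∈ U ∩ Metric.ball τ₀ ε, ∀ r : ℝ, 0 < r → r ≤ 1 →
      1 + ‖f (τ₀ + r * (τ - τ₀))‖ ≤ (1 + ‖f τ‖) * Real.exp (C * ε) := by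
    intro τ hτ r h0 h1
    refine (one_add_norm_le_of_norm_deriv_le (f' := f') hC fun t ht0 ht1 =>
      hf _ (hU.ray_mem' hτ h0 h1 ht0 ht1)).trans ?_
    rw [norm_sub_rev]
    have := mem_ball_iff_norm.mp hτ.2
    gcongr
    exact (hdist τ hτ r h0 h1).trans this.le
  have hout : ∀ τ ∈ U ∩ Metric.ball τ₀ ε, ∀ r : ℝ, 0 < r → r ≤ 1 →
      1 + ‖f τ‖ ≤ (1 + ‖f (τ₀ + r * (τ - τ₀))‖) * Real.exp (C * ε) := by
    intro τ hτ r h0 h1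
    refine (one_add_norm_le_of_norm_deriv_le (f' := f') hC fun t ht0 ht1 =>
      hf _ (hU.ray_mem hτ h0 h1 ht0 ht1)).trans ?_
    have := mem_ball_iff_norm.mp hτ.2
    gcongr
    exact (hdist τ hτ r h0 h1).trans this.le
  have hsmall : ∀ τ ∈ U, ∃ s : ℝ, 0 < s ∧ s ≤ 1 ∧ τ₀ + s * (τ - τ₀) ∈ U ∩ Metric.ball τ₀ ε := by
    intro τ hτ
    obtain ⟨s, hs, hs'⟩ := ((hU.tendsto_ray hτ).eventually_mem hV |>.and
      (Ioo_mem_nhdsGT (zero_lt_one (α := ℝ)))).exists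
    exact ⟨s, hs'.1, hs'.2.le, hs⟩
  -- the limits along any two rays agree
  have hP : ∀ x ∈ U, ∀ y ∈ U, Tendsto (fun t : ℝ => f (τ₀ + t * (x - τ₀)) - f (τ₀ + t * (y - τ₀)))
      (𝓝[>] 0) (𝓝 0) := by
    intro x hx y hy
    refine hU.isConnected.isPreconnected.induction₂ (fun x y =>
      Tendsto (fun t : ℝ => f (τ₀ + t * (x - τ₀)) - f (τ₀ + t * (y - τ₀))) (𝓝[>] 0) (𝓝 0))
      ?_ ?_ ?_ hx hy
    · intro x hx
      obtain ⟨s, hs0, hs1, hs⟩ := hsmall x hx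
      have hW : (U ∩ Metric.ball τ₀ ε) ∩ {z | ‖f z‖ < ‖f (τ₀ + s * (x - τ₀))‖ + 1} ∈
          𝓝 (τ₀ + s * (x - τ₀)) := by
        refine inter_mem ((hU.isOpen_inter_ball ε).mem_nhds hs) ?_
        exact (hf _ hs).1.continuousAt.norm.eventually_lt_const (by linarith)
      obtain ⟨r, hr, hrW⟩ := Metric.mem_nhds_iff.mp hW
      have hcont : Continuous (fun y : ℂ => τ₀ + s * (y - τ₀)) := by fun_prop
      have hev : ∀ᶠ y in 𝓝[U] x, τ₀ + s * (y - τ₀) ∈ Metric.ball (τ₀ + s * (x - τ₀)) r :=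
        (hcont.tendsto x).mono_left nhdsWithin_le_nhds (Metric.ball_mem_nhds _ hr)
      filter_upwards [hev] with y hy
      set K := C * ((2 + ‖f (τ₀ + s * (x - τ₀))‖) * Real.exp (C * ε)) with hK
      have hbound : ∀ t : ℝ, 0 < t → t ≤ s →
          ‖f (τ₀ + t * (x - τ₀)) - f (τ₀ + t * (y - τ₀))‖ ≤ K * ‖(t : ℂ) * (x - y)‖ := by
        intro t ht0 hts
        have := norm_sub_le_of_norm_deriv_le_segment (f := f) (f' := f')
          (x := τ₀ + t * (y - τ₀)) (y := τ₀ + t * (x - τ₀)) (C := K) (fun u hu0 hu1 => by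
            have hsC : (s : ℂ) ≠ 0 := by exact_mod_cast hs0.ne'
            have hz : (τ₀ + s * (y - τ₀)) + (u : ℝ) •
                ((τ₀ + s * (x - τ₀)) - (τ₀ + s * (y - τ₀))) ∈ Metric.ball (τ₀ + s * (x - τ₀)) r :=
              (convex_ball _ r).add_smul_sub_mem hy (Metric.mem_ball_self hr) ⟨hu0, hu1⟩
            -- The homothety with centre `τ₀` and ratio `t/s` carries the short segment inside the
            -- ball at level `s` onto the segment at level `t`. So the latter lies in the domain
            -- although `U` need not be convex, and its length is only `t‖x - y‖`.
            have heq : (τ₀ + t * (y - τ₀)) + u * ((τ₀ + t * (x - τ₀)) - (τ₀ + t * (y - τ₀)))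
              = τ₀ + ((t / s : ℝ) : ℂ) * (((τ₀ + s * (y - τ₀)) + (u : ℝ) •
                ((τ₀ + s * (x - τ₀)) - (τ₀ + s * (y - τ₀)))) - τ₀) := by
              simp only [Complex.real_smul]
              push_cast
              field_simp
              ring
            have hd0 : 0 < t / s := by positivity
            have hd1 : t / s ≤ 1 := (div_le_one hs0).mpr hts
            have hzV := (hrW hz).1
            have hzf : ‖f _‖ < _ := (hrW hz).2
            rw [heq]
            have h1 := hf _ (hU.mem_ball hzV hd0 hd1)
            refine ⟨h1.1, h1.2.trans ?_⟩
            rw [hK]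
            refine mul_le_mul_of_nonneg_left ((hin _ hzV _ hd0 hd1).trans ?_) hC.le
            refine mul_le_mul_of_nonneg_right ?_ (Real.exp_pos _).le
            linarith)
        refine this.trans (le_of_eq ?_)
        congr 2
        ring
      have hlim : Tendsto (fun t : ℝ => K * ‖(t : ℂ) * (x - y)‖) (𝓝[>] 0) (𝓝 0) := by
        have : Continuous (fun t : ℝ => K * ‖(t : ℂ) * (x - y)‖) := by fun_prop
        simpa using (this.tendsto 0).mono_left nhdsWithin_le_nhds
      refine squeeze_zero_norm' ?_ hlim
      filter_upwards [Ioo_mem_nhdsGT hs0] with t ht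
      exact hbound t ht.1 ht.2.le
    · intro x y z _ _ _ h1 h2
      simpa using h1.add h2
    · intro x y _ _ h1
      simpa using h1.neg
  obtain ⟨x₀, hx₀⟩ := hU.isConnected.nonempty
  obtain ⟨s, hs0, hs1, hs⟩ := hsmall x₀ hx₀
  set x := τ₀ + s * (x₀ - τ₀) with hx
  -- On one ray `f` is Lipschitz, because `hin` bounds its derivative there; hence it is Cauchy at
  -- the vertex.
  have hray : ∃ L, Tendsto (fun t : ℝ => f (τ₀ + t * (x - τ₀))) (𝓝[>] 0) (𝓝 L) := by
    rw [← cauchy_map_iff_exists_tendsto, Metric.cauchy_iff]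
    refine ⟨inferInstance, fun e he => ?_⟩
    set K := C * ((1 + ‖f x‖) * Real.exp (C * ε)) with hK
    have hKpos : 0 < K := by positivity
    have hlip : ∀ t : ℝ, 0 < t → t ≤ 1 → ∀ u : ℝ, 0 < u → u ≤ 1 →
        ‖f (τ₀ + t * (x - τ₀)) - f (τ₀ + u * (x - τ₀))‖ ≤ K * (|t - u| * ‖x - τ₀‖) := by
      intro t ht0 ht1 u hu0 hu1
      have := norm_sub_le_of_norm_deriv_le_segment (f := f) (f' := f')
        (x := τ₀ + u * (x - τ₀)) (y := τ₀ + t * (x - τ₀)) (C := K) (fun v hv0 hv1 => by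
          have heq : (τ₀ + u * (x - τ₀)) + v * ((τ₀ + t * (x - τ₀)) - (τ₀ + u * (x - τ₀)))
            = τ₀ + ((u + v * (t - u) : ℝ) : ℂ) * (x - τ₀) := by push_cast; ring
          have h0 : 0 < u + v * (t - u) := by
            rcases hv0.eq_or_lt with rfl | hv
            · simpa using hu0
            · nlinarith [mul_pos hv ht0, mul_nonneg (sub_nonneg.mpr hv1) hu0.le]
          have h1 : u + v * (t - u) ≤ 1 := by nlinarith
          rw [heq]
          have h2 := hf _ (hU.mem_ball hs h0 h1)
          exact ⟨h2.1, h2.2.trans (mul_le_mul_of_nonneg_left (hin _ hs _ h0 h1) hC.le)⟩)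
      refine this.trans (le_of_eq ?_)
      rw [← Real.norm_eq_abs, ← Complex.norm_real, ← norm_mul]
      push_cast
      congr 2
      ring
    set η := min 1 (e / (K * (‖x - τ₀‖ + 1))) with hη
    have hη0 : 0 < η := lt_min one_pos (by positivity)
    refine ⟨_, image_mem_map (Ioo_mem_nhdsGT hη0), ?_⟩
    rintro _ ⟨t, ht, rfl⟩ _ ⟨u, hu, rfl⟩
    rw [dist_eq_norm]
    refine (hlip t ht.1 (ht.2.le.trans (min_le_left _ _)) u hu.1
      (hu.2.le.trans (min_le_left _ _))).trans_lt ?_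
    have h3 : |t - u| < e / (K * (‖x - τ₀‖ + 1)) := by
      refine lt_of_lt_of_le ?_ (min_le_right 1 _)
      rw [abs_lt]
      constructor <;> linarith [ht.1, ht.2, hu.1, hu.2]
    rw [lt_div_iff₀ (by positivity)] at h3
    nlinarith [mul_nonneg (abs_nonneg (t - u)) hKpos.le]
  obtain ⟨L, hL⟩ := hray
  have hrays : ∀ τ ∈ U, Tendsto (fun t : ℝ => f (τ₀ + t * (τ - τ₀))) (𝓝[>] 0) (𝓝 L) := by
    intro τ hτ
    simpa using (hP τ hτ x hs.1).add hL
  -- Letting `r → 0` in `hout` bounds `f` by its common radial limit `L`, with a constant that is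
  -- the same for all rays. This turns radial limits into a limit within `U`.
  have hbd : ∀ τ ∈ U ∩ Metric.ball τ₀ ε, 1 + ‖f τ‖ ≤ (1 + ‖L‖) * Real.exp (C * ε) := by
    intro τ hτ
    refine ge_of_tendsto (((hrays τ hτ.1).norm.const_add 1).mul_const _) ?_
    filter_upwards [Ioo_mem_nhdsGT (zero_lt_one (α := ℝ))] with r hr
    exact hout τ hτ r hr.1 hr.2.le
  set N := (1 + ‖L‖) * Real.exp (C * ε) with hN
  have hN0 : 0 < N := by positivity
  have hlin : ∀ τ ∈ U ∩ Metric.ball τ₀ ε, ‖f τ - L‖ ≤ C * N * ‖τ - τ₀‖ := by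
    intro τ hτ
    refine le_of_tendsto ((tendsto_const_nhds (x := f τ)).sub (hrays τ hτ.1)).norm ?_
    filter_upwards [Ioo_mem_nhdsGT (zero_lt_one (α := ℝ))] with r hr
    refine (norm_sub_le_of_norm_deriv_le_segment (f := f) (f' := f') (C := C * N)
      (fun t h0 h1 => ?_)).trans (mul_le_mul_of_nonneg_left (hdist τ hτ r hr.1 hr.2.le)
        (by positivity))
    have h2 := hf _ (hU.ray_mem hτ hr.1 hr.2.le h0 h1)
    exact ⟨h2.1, h2.2.trans (mul_le_mul_of_nonneg_left
      (hbd _ (hU.ray_mem hτ hr.1 hr.2.le h0 h1)) hC.le)⟩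
  refine ⟨L, N + C * N, by positivity, ?_, fun τ hτ => ⟨?_, ?_, ?_⟩⟩
  · rw [tendsto_iff_norm_sub_tendsto_zero]
    have hlim : Tendsto (fun τ => C * N * ‖τ - τ₀‖) (𝓝[U] τ₀) (𝓝 0) := by
      have : Continuous (fun τ => C * N * ‖τ - τ₀‖) := by fun_prop
      simpa using (this.tendsto τ₀).mono_left nhdsWithin_le_nhds
    refine squeeze_zero' (.of_forall fun _ => norm_nonneg _) ?_ hlim
    filter_upwards [hV] with τ hτ using hlin τ hτ
  · nlinarith [hbd τ hτ, mul_pos hC hN0]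
  · refine (hf τ hτ).2.trans ?_
    nlinarith [mul_le_mul_of_nonneg_left (hbd τ hτ) hC.le]
  · refine (hlin τ hτ).trans ?_
    gcongr
    linarith

end IsBranchDomain

/-! ### Asymptotics of the model system for `q` and `w` -/

namespace IsBranchDomain

variable {τ₀ : ℂ} {U : Set ℂ}

theorem isBigO_sub (hU : IsBranchDomain τ₀ U) {ε : ℝ} {f f' : ℂ → ℂ} {L : ℂ} {k : ℕ}
    (hf : ∀ τ ∈ U ∩ Metric.ball τ₀ ε, HasDerivAt f (f' τ) τ)
    (hO : f' =O[𝓟 (U ∩ Metric.ball τ₀ ε)] fun τ => (τ - τ₀) ^ k)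
    (hL : Tendsto f (𝓝[U] τ₀) (𝓝 L)) :
    (fun τ => f τ - L) =O[𝓟 (U ∩ Metric.ball τ₀ ε)] fun τ => (τ - τ₀) ^ (k + 1) := by
  obtain ⟨C, hC, h⟩ := hO.exists_nonneg
  rw [isBigOWith_principal] at h
  refine isBigO_principal.mpr ⟨C, fun τ hτ => ?_⟩
  rw [norm_pow]
  refine hU.norm_sub_limit_le (f' := f') (fun τ hτ => ⟨hf τ hτ, ?_⟩) hL hC hτ
  rw [← norm_pow]
  exact h τ hτ

theorem exists_tendsto_of_isBigO_one (hU : IsBranchDomain τ₀ U) {ε : ℝ} (hε : 0 < ε)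
    {f f' : ℂ → ℂ} (hf : ∀ τ ∈ U ∩ Metric.ball τ₀ ε, HasDerivAt f (f' τ) τ)
    (hO : f' =O[𝓟 (U ∩ Metric.ball τ₀ ε)] fun _ => (1 : ℂ)) :
    ∃ L : ℂ, Tendsto f (𝓝[U] τ₀) (𝓝 L) := by
  obtain ⟨C, hC, h⟩ := hO.exists_pos
  rw [isBigOWith_principal] at h
  obtain ⟨L, -, -, hL, -⟩ := hU.exists_tendsto_of_norm_deriv_le hε hC (f := f) (f' := f')
    (fun τ hτ => ⟨hf τ hτ, (h τ hτ).trans (mul_le_mul_of_nonneg_left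
      (by rw [norm_one]; linarith [norm_nonneg (f τ)]) hC.le)⟩)
  exact ⟨L, hL⟩

/-- Solutions `(q, w)` with `q → 0` of a system of the form
`q' = α (4 w - 1 + 4 q η + O(q²))`, `w' = α (2 H + O(q (1 + |w|)))`,
`q H = (w - 1/4)² - ν²`, near the vertex of a branch domain. -/
theorem exists_expansion (hU : IsBranchDomain τ₀ U) {ε : ℝ} (hε : 0 < ε) {α ν η₀ : ℂ}
    {q w H η Eq Ew : ℂ → ℂ}
    (hq : ∀ τ ∈ U ∩ Metric.ball τ₀ ε,
      HasDerivAt q (α * (4 * w τ - 1 + 4 * q τ * η τ + Eq τ)) τ)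
    (hw : ∀ τ ∈ U ∩ Metric.ball τ₀ ε, HasDerivAt w (α * (2 * H τ + Ew τ)) τ)
    (hEq : Eq =O[𝓟 (U ∩ Metric.ball τ₀ ε)] fun τ => q τ ^ 2)
    (hEw : Ew =O[𝓟 (U ∩ Metric.ball τ₀ ε)] fun τ => ‖q τ‖ * (1 + ‖w τ‖))
    (hH : ∀ τ ∈ U ∩ Metric.ball τ₀ ε, (w τ - 1 / 4) ^ 2 = ν ^ 2 + q τ * H τ)
    (hq0 : ∀ τ ∈ U ∩ Metric.ball τ₀ ε, q τ ≠ 0)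
    (hq1 : ∀ τ ∈ U ∩ Metric.ball τ₀ ε, ‖q τ‖ ≤ 1)
    (hη : (fun τ => η τ - η₀) =O[𝓟 (U ∩ Metric.ball τ₀ ε)] fun τ => τ - τ₀)
    (hlim : Tendsto q (𝓝[U] τ₀) (𝓝 0)) :
    ∃ L H₀ : ℂ, L ^ 2 = ν ^ 2 ∧ Tendsto w (𝓝[U] τ₀) (𝓝 (1 / 4 + L)) ∧
      Tendsto H (𝓝[U] τ₀) (𝓝 H₀) ∧
      (fun τ => q τ - 4 * α * L * (τ - τ₀) -
        (4 * α ^ 2 * H₀ + 8 * α ^ 2 * η₀ * L) * (τ - τ₀) ^ 2)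
        =O[𝓟 (U ∩ Metric.ball τ₀ ε)] fun τ => (τ - τ₀) ^ 3 := by
  set V := U ∩ Metric.ball τ₀ ε with hVdef
  have hVopen : IsOpen V := hU.isOpen_inter_ball ε
  have hV : V ∈ 𝓝[U] τ₀ :=
    inter_mem self_mem_nhdsWithin (mem_nhdsWithin_of_mem_nhds (Metric.ball_mem_nhds τ₀ hε))
  have hd1 : (fun τ => τ - τ₀) =O[𝓟 V] fun _ => (1 : ℂ) := by
    refine isBigO_principal.mpr ⟨ε, fun τ hτ => ?_⟩
    simpa using (mem_ball_iff_norm.mp hτ.2).le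
  have hη1 : η =O[𝓟 V] fun _ => (1 : ℂ) := by
    simpa using (hη.trans hd1).add (isBigO_const_const η₀ (one_ne_zero (α := ℂ)) (𝓟 V))
  have hq1' : q =O[𝓟 V] fun _ => (1 : ℂ) :=
    isBigO_principal.mpr ⟨1, fun τ hτ => by simpa using hq1 τ hτ⟩
  -- the derivative of `H`
  have hHd : ∀ τ ∈ V, HasDerivAt H
      (α * ((2 * w τ - 1 / 2) * (Ew τ / q τ) - H τ * (4 * η τ + Eq τ / q τ))) τ := by
    intro τ hτ
    have h1 := ((((hw τ hτ).sub_const (1 / 4)).pow 2).sub_const (ν ^ 2)).div (hq τ hτ) (hq0 τ hτ)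
    have h2 : H =ᶠ[𝓝 τ] fun t => ((w t - 1 / 4) ^ 2 - ν ^ 2) / q t := by
      filter_upwards [hVopen.mem_nhds hτ] with t ht
      rw [hH t ht, add_sub_cancel_left, mul_div_cancel_left₀ _ (hq0 t ht)]
    -- The crucial cancellation: `w'` contributes `2(2w - 1/2)H/q` and `q'` contributes `-(4w -
    -- 1)H/q`, which sum to zero. Only the bounded quotients `Ew/q` (up to the factor `1 + |w|`),
    -- `Eq/q` and `η` survive.
    refine (h1.congr_of_eventuallyEq h2).congr_deriv ?_
    have h3 : (w τ - 1 / 4) ^ 2 - ν ^ 2 = q τ * H τ := by rw [hH τ hτ]; ring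
    have := hq0 τ hτ
    simp only [Pi.pow_apply, h3]
    field_simp
    ring
  obtain ⟨H₀, M, hM, hH₀, hHb⟩ : ∃ L : ℂ, ∃ M : ℝ, 0 ≤ M ∧ Tendsto H (𝓝[U] τ₀) (𝓝 L) ∧
      ∀ τ ∈ V, ‖H τ‖ ≤ M ∧
        ‖α * ((2 * w τ - 1 / 2) * (Ew τ / q τ) - H τ * (4 * η τ + Eq τ / q τ))‖ ≤ M ∧
        ‖H τ - L‖ ≤ M * ‖τ - τ₀‖ := by
    obtain ⟨a, ha, hEqa⟩ := hEq.exists_pos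
    obtain ⟨b, hb, hEwb⟩ := hEw.exists_pos
    obtain ⟨c, hc, hηc⟩ := hη1.exists_pos
    rw [isBigOWith_principal] at hEqa hEwb hηc
    refine hU.exists_tendsto_of_norm_deriv_le hε
      (C := ‖α‖ * (2 * b * (6 + 2 * ‖ν‖ ^ 2) + (4 * c + a)) + 1) (by positivity)
      fun τ hτ => ⟨hHd τ hτ, ?_⟩
    have hqpos : 0 < ‖q τ‖ := norm_pos_iff.mpr (hq0 τ hτ)
    have e1 : ‖Eq τ / q τ‖ ≤ a := by
      rw [norm_div, div_le_iff₀ hqpos]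
      have := hEqa τ hτ
      rw [norm_pow] at this
      nlinarith [mul_nonneg ha.le hqpos.le, hq1 τ hτ]
    have e2 : ‖Ew τ / q τ‖ ≤ b * (1 + ‖w τ‖) := by
      rw [norm_div, div_le_iff₀ hqpos]
      have := hEwb τ hτ
      rw [Real.norm_of_nonneg (by positivity)] at this
      linarith
    have e3 : ‖η τ‖ ≤ c := by simpa using hηc τ hτ
    -- By the relation `hH`, `w` grows at most like the square root of `H`, so the term quadratic in
    -- `w` in `H'` is still linear in `H`.
    have e4 : ‖w τ - 1 / 4‖ ^ 2 ≤ ‖ν‖ ^ 2 + ‖H τ‖ := by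
      rw [← norm_pow, hH τ hτ]
      refine (norm_add_le _ _).trans ?_
      rw [norm_pow, norm_mul]
      gcongr
      exact mul_le_of_le_one_left (norm_nonneg _) (hq1 τ hτ)
    have e5 : ‖w τ‖ ≤ ‖w τ - 1 / 4‖ + 1 / 4 := by
      calc ‖w τ‖ = ‖(w τ - 1 / 4) + 1 / 4‖ := by ring_nf
        _ ≤ _ := (norm_add_le _ _).trans (by norm_num)
    have e6 : ‖2 * w τ - 1 / 2‖ = 2 * ‖w τ - 1 / 4‖ := by
      rw [show 2 * w τ - 1 / 2 = 2 * (w τ - 1 / 4) by ring, norm_mul]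
      norm_num
    set x := ‖w τ - 1 / 4‖ with hx
    have hx0 : 0 ≤ x := norm_nonneg _
    have e7 : ‖(2 * w τ - 1 / 2) * (Ew τ / q τ)‖ ≤ 2 * b * (6 + 2 * ‖ν‖ ^ 2) * (1 + ‖H τ‖) := by
      rw [norm_mul, e6]
      calc 2 * x * ‖Ew τ / q τ‖ ≤ 2 * x * (b * (1 + (x + 1 / 4))) := by
              have : ‖Ew τ / q τ‖ ≤ b * (1 + (x + 1 / 4)) := e2.trans (by gcongr)
              gcongr
        _ = 2 * b * (x * (x + 5 / 4)) := by ring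
        _ ≤ 2 * b * ((6 + 2 * ‖ν‖ ^ 2) * (1 + ‖H τ‖)) := by
          refine mul_le_mul_of_nonneg_left ?_ (by positivity)
          nlinarith [sq_nonneg (x - 1), norm_nonneg (H τ), sq_nonneg ‖ν‖,
            mul_nonneg (sq_nonneg ‖ν‖) (norm_nonneg (H τ))]
        _ = _ := by ring
    have e8 : ‖H τ * (4 * η τ + Eq τ / q τ)‖ ≤ (4 * c + a) * (1 + ‖H τ‖) := by
      have : ‖4 * η τ + Eq τ / q τ‖ ≤ 4 * c + a := by
        refine (norm_add_le _ _).trans ?_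
        rw [norm_mul, Complex.norm_ofNat]
        gcongr
      rw [norm_mul]
      nlinarith [norm_nonneg (H τ), mul_le_mul_of_nonneg_left this (norm_nonneg (H τ))]
    rw [norm_mul]
    have e9 := mul_le_mul_of_nonneg_left ((norm_sub_le _ _).trans (add_le_add e7 e8))
      (norm_nonneg α)
    nlinarith [norm_nonneg (H τ)]
  have hHO : (fun τ => H τ - H₀) =O[𝓟 V] fun τ => τ - τ₀ :=
    isBigO_principal.mpr ⟨M, fun τ hτ => (hHb τ hτ).2.2⟩
  have hH1 : H =O[𝓟 V] fun _ => (1 : ℂ) :=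
    isBigO_principal.mpr ⟨M, fun τ hτ => by simpa using (hHb τ hτ).1⟩
  have hw1 : w =O[𝓟 V] fun _ => (1 : ℂ) := by
    refine isBigO_principal.mpr ⟨2 + ‖ν‖ ^ 2 + M, fun τ hτ => ?_⟩
    have e4 : ‖w τ - 1 / 4‖ ^ 2 ≤ ‖ν‖ ^ 2 + ‖H τ‖ := by
      rw [← norm_pow, hH τ hτ]
      refine (norm_add_le _ _).trans ?_
      rw [norm_pow, norm_mul]
      gcongr
      exact mul_le_of_le_one_left (norm_nonneg _) (hq1 τ hτ)
    have e5 : ‖w τ‖ ≤ ‖w τ - 1 / 4‖ + 1 / 4 := by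
      calc ‖w τ‖ = ‖(w τ - 1 / 4) + 1 / 4‖ := by ring_nf
        _ ≤ _ := (norm_add_le _ _).trans (by norm_num)
    rw [norm_one, mul_one]
    nlinarith [(hHb τ hτ).1, sq_nonneg (‖w τ - 1 / 4‖ - 1)]
  have hEw' : Ew =O[𝓟 V] q := by
    have : (fun τ => 1 + ‖w τ‖) =O[𝓟 V] fun _ => (1 : ℝ) :=
      (isBigO_refl _ _).add (by simpa using hw1.norm_norm)
    refine hEw.trans ?_
    simpa using ((isBigO_refl (fun τ => ‖q τ‖) (𝓟 V)).mul this)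
  have hqd1 : (fun τ => α * (4 * w τ - 1 + 4 * q τ * η τ + Eq τ)) =O[𝓟 V] fun _ => (1 : ℂ) := by
    have h1 : (fun τ => 4 * w τ - 1) =O[𝓟 V] fun _ => (1 : ℂ) :=
      (hw1.const_mul_left 4).sub (isBigO_refl _ _)
    have h2 : (fun τ => 4 * q τ * η τ) =O[𝓟 V] fun _ => (1 : ℂ) := by
      simpa using (hq1'.const_mul_left 4).mul hη1
    have h3 : Eq =O[𝓟 V] fun _ => (1 : ℂ) := by simpa using hEq.trans (hq1'.pow 2)
    exact ((h1.add h2).add h3).const_mul_left α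
  have hqd : q =O[𝓟 V] fun τ => τ - τ₀ := by
    simpa using hU.isBigO_sub (k := 0) hq (by simpa using hqd1) hlim
  have hEqd : Eq =O[𝓟 V] fun τ => (τ - τ₀) ^ 2 := hEq.trans (hqd.pow 2)
  obtain ⟨W, hW⟩ := hU.exists_tendsto_of_isBigO_one hε hw
    (((hH1.const_mul_left 2).add (hEw'.trans hq1')).const_mul_left α)
  have hWO : (fun τ => w τ - W) =O[𝓟 V] fun τ => τ - τ₀ := by
    simpa using hU.isBigO_sub (k := 0) hw
      (by simpa using ((hH1.const_mul_left 2).add (hEw'.trans hq1')).const_mul_left α) hW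
  have hWν : (W - 1 / 4) ^ 2 = ν ^ 2 := by
    have h1 : Tendsto (fun τ => (w τ - 1 / 4) ^ 2) (𝓝[U] τ₀) (𝓝 ((W - 1 / 4) ^ 2)) :=
      (hW.sub_const _).pow 2
    have h2 : Tendsto (fun τ => ν ^ 2 + q τ * H τ) (𝓝[U] τ₀) (𝓝 (ν ^ 2 + 0 * H₀)) :=
      (hlim.mul hH₀).const_add _
    have := hU.neBot
    have h3 := tendsto_nhds_unique (h1.congr' (by filter_upwards [hV] with τ hτ using hH τ hτ)) h2
    simpa using h3
  have hid : ∀ c : ℂ, ∀ k : ℕ, Tendsto (fun τ => c * (τ - τ₀) ^ (k + 1)) (𝓝[U] τ₀) (𝓝 0) := by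
    intro c k
    have : Continuous (fun τ : ℂ => c * (τ - τ₀) ^ (k + 1)) := by fun_prop
    simpa using (this.tendsto τ₀).mono_left nhdsWithin_le_nhds
  have hlin : ∀ c τ : ℂ, HasDerivAt (fun τ => c * (τ - τ₀)) c τ := by
    intro c τ
    simpa using ((hasDerivAt_id τ).sub_const τ₀).const_mul c
  -- second order expansion of `w`
  have hw2 : (fun τ => w τ - 2 * α * H₀ * (τ - τ₀) - W) =O[𝓟 V] fun τ => (τ - τ₀) ^ 2 := by
    refine hU.isBigO_sub (k := 1) (f := fun τ => w τ - 2 * α * H₀ * (τ - τ₀))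
      (f' := fun τ => α * (2 * (H τ - H₀) + Ew τ)) (fun τ hτ => ?_) ?_ ?_
    · exact ((hw τ hτ).sub (hlin (2 * α * H₀) τ)).congr_deriv (by ring)
    · simpa using ((hHO.const_mul_left 2).add (hEw'.trans hqd)).const_mul_left α
    · simpa using hW.sub (hid (2 * α * H₀) 0)
  have hq2 : (fun τ => q τ - 4 * α * (W - 1 / 4) * (τ - τ₀)) =O[𝓟 V] fun τ => (τ - τ₀) ^ 2 := by
    have := hU.isBigO_sub (ε := ε) (k := 1) (L := 0) (f := fun τ => q τ - 4 * α * (W - 1 / 4) * (τ - τ₀))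
      (f' := fun τ => α * (4 * (w τ - W) + 4 * q τ * η τ + Eq τ)) (fun τ hτ => ?_) ?_ ?_
    · simpa using this
    · exact ((hq τ hτ).sub (hlin (4 * α * (W - 1 / 4)) τ)).congr_deriv (by ring)
    · have h2 : (fun τ => 4 * q τ * η τ) =O[𝓟 V] fun τ => τ - τ₀ := by
        simpa using (hqd.const_mul_left 4).mul hη1
      have h3 : Eq =O[𝓟 V] fun τ => τ - τ₀ := by
        refine hEqd.trans ?_
        simpa [sq] using (isBigO_refl (fun τ => τ - τ₀) (𝓟 V)).mul hd1
      simpa using (((hWO.const_mul_left 4).add h2).add h3).const_mul_left α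
    · simpa using hlim.sub (hid (4 * α * (W - 1 / 4)) 0)
  refine ⟨W - 1 / 4, H₀, hWν, by simpa using hW, hH₀, ?_⟩
  -- Insert `w ≈ W + 2αH₀(τ-τ₀)` and `qη ≈ 4αLη₀(τ-τ₀)`, with `L = W - 1/4`, in the equation for
  -- `q'`. The linear term is `(8α²H₀ + 16α²η₀L)(τ-τ₀)`, and integrating halves it.
  have := hU.isBigO_sub (ε := ε) (k := 2) (L := 0) (f := fun τ => q τ - 4 * α * (W - 1 / 4) * (τ - τ₀) -
        (4 * α ^ 2 * H₀ + 8 * α ^ 2 * η₀ * (W - 1 / 4)) * (τ - τ₀) ^ 2)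
      (f' := fun τ => α * (4 * (w τ - 2 * α * H₀ * (τ - τ₀) - W) +
        4 * η₀ * (q τ - 4 * α * (W - 1 / 4) * (τ - τ₀)) + 4 * (q τ * (η τ - η₀)) + Eq τ))
      (fun τ hτ => ?_) ?_ ?_
  · simpa using this
  · have h1 : HasDerivAt (fun τ => (4 * α ^ 2 * H₀ + 8 * α ^ 2 * η₀ * (W - 1 / 4)) * (τ - τ₀) ^ 2)
        ((4 * α ^ 2 * H₀ + 8 * α ^ 2 * η₀ * (W - 1 / 4)) * (2 * (τ - τ₀))) τ := by
      simpa using (((hasDerivAt_id τ).sub_const τ₀).pow 2).const_mul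
        (4 * α ^ 2 * H₀ + 8 * α ^ 2 * η₀ * (W - 1 / 4))
    exact (((hq τ hτ).sub (hlin (4 * α * (W - 1 / 4)) τ)).sub h1).congr_deriv (by ring)
  · have h3 : (fun τ => q τ * (η τ - η₀)) =O[𝓟 V] fun τ => (τ - τ₀) ^ 2 := by
      simpa [sq] using hqd.mul hη
    exact ((((hw2.const_mul_left 4).add (hq2.const_mul_left (4 * η₀))).add
      (h3.const_mul_left 4)).add hEqd).const_mul_left α
  · simpa using (hlim.sub (hid (4 * α * (W - 1 / 4)) 0)).sub
      (hid (4 * α ^ 2 * H₀ + 8 * α ^ 2 * η₀ * (W - 1 / 4)) 1)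

end IsBranchDomain

/-! ### Lattice sums over `ℤ × ℤ`, uniformly in τ -/

/-- The point `m + n τ` of the lattice `Λ_τ`. -/
def tauPt (τ : ℂ) (x : ℤ × ℤ) : ℂ := x.1 + x.2 * τ

/-- The weight `1 / (1 + |m + n τ|)`, whose cube is summable. -/
noncomputable def tauWeight (τ : ℂ) (x : ℤ × ℤ) : ℝ := (1 + ‖tauPt τ x‖)⁻¹

theorem tauPt_zero (τ : ℂ) : tauPt τ 0 = 0 := by simp [tauPt]

theorem tauWeight_zero (τ : ℂ) : tauWeight τ 0 = 1 := by simp [tauWeight, tauPt_zero]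

theorem tauWeight_pos (τ : ℂ) (x : ℤ × ℤ) : 0 < tauWeight τ x := by
  unfold tauWeight; positivity

theorem tauWeight_le_one (τ : ℂ) (x : ℤ × ℤ) : tauWeight τ x ≤ 1 :=
  inv_le_one_of_one_le₀ (by linarith [norm_nonneg (tauPt τ x)])

section lattice

variable {τ : ℂ}

theorem tauPair_ω₁ : (tauPair (UpperHalfPlane.ofComplex τ)).ω₁ = 1 := rfl

theorem tauPair_ω₂ (hτ : 0 < τ.im) : (tauPair (UpperHalfPlane.ofComplex τ)).ω₂ = τ := by
  simp [tauPair, UpperHalfPlane.ofComplex_apply_of_im_pos hτ]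

theorem latticeEquivProd_symm_eq_tauPt (hτ : 0 < τ.im) (x : ℤ × ℤ) :
    ((tauPair (UpperHalfPlane.ofComplex τ)).latticeEquivProd.symm x : ℂ) = tauPt τ x := by
  rw [PeriodPair.latticeEquiv_symm_apply, tauPair_ω₁, tauPair_ω₂ hτ, mul_one, tauPt]

theorem mem_tauLattice (hτ : 0 < τ.im) {z : ℂ} : z ∈ tauLattice τ ↔ ∃ x, tauPt τ x = z := by
  rw [tauLattice, SetLike.mem_coe, PeriodPair.mem_lattice, tauPair_ω₁, tauPair_ω₂ hτ]
  simp [tauPt]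

theorem zero_mem_tauLattice (τ : ℂ) : 0 ∈ tauLattice τ :=
  (tauPair (UpperHalfPlane.ofComplex τ)).lattice.zero_mem

theorem tauPt_ne_of_notMem (hτ : 0 < τ.im) {z : ℂ} (hz : z ∉ tauLattice τ) (x : ℤ × ℤ) :
    tauPt τ x ≠ z := fun h => hz ((mem_tauLattice hτ).mpr ⟨x, h⟩)

theorem tauPt_ne_zero (hτ : 0 < τ.im) {x : ℤ × ℤ} (hx : x ≠ 0) : tauPt τ x ≠ 0 := by
  rw [← latticeEquivProd_symm_eq_tauPt hτ]
  simpa using hx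

/-- Moves sums over the varying lattice to a fixed index set, so that sums for different τ can be
compared term by term. -/
theorem hasSum_tauPt_iff (hτ : 0 < τ.im) {f : ℂ → ℂ} {s : ℂ} :
    HasSum (fun x => f (tauPt τ x)) s ↔
      HasSum (fun l : (tauPair (UpperHalfPlane.ofComplex τ)).lattice => f l) s := by
  rw [← (tauPair (UpperHalfPlane.ofComplex τ)).latticeEquivProd.symm.toEquiv.hasSum_iff]
  simp only [← latticeEquivProd_symm_eq_tauPt hτ]
  rfl

theorem hasSum_wp (hτ : 0 < τ.im) (z : ℂ) :
    HasSum (fun x => (z - tauPt τ x)⁻¹ ^ 2 - (tauPt τ x)⁻¹ ^ 2) (wp τ z) := by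
  refine (hasSum_tauPt_iff hτ (f := fun l => (z - l)⁻¹ ^ 2 - l⁻¹ ^ 2)).mpr ?_
  simpa [wp] using (tauPair (UpperHalfPlane.ofComplex τ)).hasSum_weierstrassP z

theorem hasSum_wpDeriv (hτ : 0 < τ.im) (z : ℂ) :
    HasSum (fun x => -2 * (z - tauPt τ x)⁻¹ ^ 3) (wpDeriv τ z) := by
  refine (hasSum_tauPt_iff hτ (f := fun l => -2 * (z - l)⁻¹ ^ 3)).mpr ?_
  simpa [wpDeriv, div_eq_mul_inv] using
    (tauPair (UpperHalfPlane.ofComplex τ)).hasSum_derivWeierstrassP z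

/-- The sum is odd under `l ↦ -l`. Adding multiples of it to the series of ζ, ℘, ℘' removes one more
Taylor term from each summand at no cost. -/
theorem hasSum_tauPt_inv_pow_three (hτ : 0 < τ.im) : HasSum (fun x => (tauPt τ x)⁻¹ ^ 3) 0 := by
  refine (hasSum_tauPt_iff hτ (f := fun l => l⁻¹ ^ 3)).mpr ?_
  have h := (tauPair (UpperHalfPlane.ofComplex τ)).hasSum_sumInvPow 0 (r := 3) (by norm_num)
  rw [PeriodPair.sumInvPow_zero, PeriodPair.G_eq_zero_of_odd _ 3 (by decide)] at h
  simpa using h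

theorem summable_tauWeight (hτ : 0 < τ.im) : Summable fun x => tauWeight τ x ^ 3 := by
  set P := tauPair (UpperHalfPlane.ofComplex τ) with hP
  have h := ZLattice.summable_norm_sub_inv_pow P.lattice 3 (by simp) (1 / 2 : ℂ)
  have h2 : Summable fun x : ℤ × ℤ => ‖tauPt τ x - 1 / 2‖⁻¹ ^ 3 := by
    have := (P.latticeEquivProd.symm.toEquiv.summable_iff).mpr h
    refine this.congr fun x => ?_
    simp only [← latticeEquivProd_symm_eq_tauPt hτ]
    rfl
  refine h2.of_nonneg_of_le (fun x => (pow_pos (tauWeight_pos τ x) 3).le) fun x => ?_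
  have hne : tauPt τ x - 1 / 2 ≠ 0 := by
    refine sub_ne_zero.mpr (tauPt_ne_of_notMem hτ ?_ x)
    exact P.ω₁_div_two_notMem_lattice
  refine pow_le_pow_left₀ (tauWeight_pos τ x).le ?_ 3
  refine inv_anti₀ (norm_pos_iff.mpr hne) ((norm_sub_le _ _).trans ?_)
  have : ‖(1 / 2 : ℂ)‖ = 1 / 2 := by norm_num
  rw [this]
  linarith

end lattice

section bounds

variable {τ₀ : ℂ}

/-- From `|Im(m + nτ₀)| = |n| Im τ₀`. Moving τ displaces a lattice point by `n(τ - τ₀)`, so this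
makes the displacement small relative to `1 + |l|`. -/
theorem norm_int_mul_tauWeight_le (hτ₀ : 0 < τ₀.im) (x : ℤ × ℤ) :
    ‖(x.2 : ℂ)‖ * tauWeight τ₀ x ≤ τ₀.im⁻¹ := by
  have h1 : ‖(x.2 : ℂ)‖ * τ₀.im ≤ ‖tauPt τ₀ x‖ := by
    refine le_trans (le_of_eq ?_) (Complex.abs_im_le_norm _)
    simp [tauPt, abs_mul, abs_of_pos hτ₀]
  rw [tauWeight, ← div_eq_mul_inv, div_le_iff₀ (by positivity), ← div_eq_inv_mul,
    le_div_iff₀ hτ₀]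
  linarith

theorem tauPt_sub_tauPt (τ τ₀ : ℂ) (x : ℤ × ℤ) :
    tauPt τ x - tauPt τ₀ x = x.2 * (τ - τ₀) := by
  simp [tauPt]; ring

/-- Away from its poles, `1 / (z - l)` is bounded by a multiple of the weight of the lattice point
`l`, uniformly in `l` and locally uniformly in the lattice and in `z`. -/
theorem exists_norm_inv_sub_tauPt_le (hτ₀ : 0 < τ₀.im) {z₀ : ℂ} {S : Set (ℤ × ℤ)}
    (hS : ∀ x ∈ S, tauPt τ₀ x ≠ z₀) :
    ∃ D : ℝ, 0 < D ∧ ∀ᶠ p : ℂ × ℂ in 𝓝 (τ₀, z₀), ∀ x ∈ S,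
      p.2 - tauPt p.1 x ≠ 0 ∧ ‖(p.2 - tauPt p.1 x)⁻¹‖ ≤ D * tauWeight τ₀ x := by
  have hclosed : IsClosed (tauPt τ₀ '' S) := by
    refine (tauPair (UpperHalfPlane.ofComplex τ₀)).isClosed_of_subset_lattice ?_
    rintro _ ⟨x, -, rfl⟩
    exact (mem_tauLattice hτ₀).mpr ⟨x, rfl⟩
  obtain ⟨d, hd, hball⟩ := Metric.isOpen_iff.mp hclosed.isOpen_compl z₀ (by
    rintro ⟨x, hx, h⟩
    exact hS x hx h)
  have hdist : ∀ x ∈ S, d ≤ ‖z₀ - tauPt τ₀ x‖ := by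
    intro x hx
    by_contra! h
    have hmem : tauPt τ₀ x ∈ Metric.ball z₀ d := by
      rwa [Metric.mem_ball, dist_comm, dist_eq_norm]
    exact hball hmem ⟨x, hx, rfl⟩
  set K := (1 + ‖z₀‖) / d + 1 with hK
  have hK0 : 0 < K := by positivity
  -- The distance from `z₀` to the lattice points in question is at least `d` and grows like `|l|`,
  -- hence is comparable to `1 + |l|`. The choice `δ = 1/(2K)` below leaves half of it after
  -- perturbing `τ` and `z`.
  have hlow : ∀ x ∈ S, 1 + ‖tauPt τ₀ x‖ ≤ K * ‖z₀ - tauPt τ₀ x‖ := by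
    intro x hx
    have h1 : ‖tauPt τ₀ x‖ ≤ ‖z₀‖ + ‖z₀ - tauPt τ₀ x‖ := by
      calc ‖tauPt τ₀ x‖ = ‖z₀ - (z₀ - tauPt τ₀ x)‖ := by ring_nf
        _ ≤ _ := norm_sub_le _ _
    have h2 : 1 + ‖z₀‖ ≤ (1 + ‖z₀‖) / d * ‖z₀ - tauPt τ₀ x‖ := by
      rw [div_mul_eq_mul_div, le_div_iff₀ hd]
      exact mul_le_mul_of_nonneg_left (hdist x hx) (by positivity)
    rw [hK, add_mul, one_mul]
    linarith
  set δ := 1 / (2 * K) with hδ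
  have hδ0 : 0 < δ := by positivity
  refine ⟨1 / δ, by positivity, ?_⟩
  have hev : ∀ᶠ p : ℂ × ℂ in 𝓝 (τ₀, z₀), ‖p.2 - z₀‖ + ‖p.1 - τ₀‖ * τ₀.im⁻¹ < δ := by
    have hc : Continuous fun p : ℂ × ℂ => ‖p.2 - z₀‖ + ‖p.1 - τ₀‖ * τ₀.im⁻¹ := by fun_prop
    refine (hc.tendsto (τ₀, z₀)).eventually_lt_const ?_
    simpa using hδ0
  filter_upwards [hev] with p hp x hx
  have hw := tauWeight_pos τ₀ x
  have hw1 : (1 + ‖tauPt τ₀ x‖) * tauWeight τ₀ x = 1 := mul_inv_cancel₀ (by positivity)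
  have h1 : δ * (1 + ‖tauPt τ₀ x‖) ≤ ‖p.2 - tauPt p.1 x‖ := by
    have e1 : 2 * δ * (1 + ‖tauPt τ₀ x‖) ≤ ‖z₀ - tauPt τ₀ x‖ := by
      have := hlow x hx
      rw [hδ]
      field_simp
      linarith
    have e2 : ‖z₀ - tauPt τ₀ x‖ ≤ ‖p.2 - tauPt p.1 x‖ + (‖p.2 - z₀‖ + ‖(x.2 : ℂ)‖ * ‖p.1 - τ₀‖) := by
      calc ‖z₀ - tauPt τ₀ x‖
          = ‖(p.2 - tauPt p.1 x) + (-(p.2 - z₀) + (x.2 : ℂ) * (p.1 - τ₀))‖ := by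
            rw [← tauPt_sub_tauPt]; ring_nf
        _ ≤ ‖p.2 - tauPt p.1 x‖ + (‖-(p.2 - z₀)‖ + ‖(x.2 : ℂ) * (p.1 - τ₀)‖) :=
          (norm_add_le _ _).trans (add_le_add_right (norm_add_le _ _) _)
        _ = _ := by rw [norm_neg, norm_mul]
    have e3 : ‖(x.2 : ℂ)‖ ≤ τ₀.im⁻¹ * (1 + ‖tauPt τ₀ x‖) := by
      have := mul_le_mul_of_nonneg_right (norm_int_mul_tauWeight_le hτ₀ x)
        (show 0 ≤ 1 + ‖tauPt τ₀ x‖ by positivity)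
      rwa [mul_assoc, mul_comm (tauWeight τ₀ x), hw1, mul_one] at this
    have e4 : ‖p.2 - z₀‖ + ‖(x.2 : ℂ)‖ * ‖p.1 - τ₀‖ ≤ δ * (1 + ‖tauPt τ₀ x‖) := by
      calc ‖p.2 - z₀‖ + ‖(x.2 : ℂ)‖ * ‖p.1 - τ₀‖
          ≤ ‖p.2 - z₀‖ * (1 + ‖tauPt τ₀ x‖) + τ₀.im⁻¹ * (1 + ‖tauPt τ₀ x‖) * ‖p.1 - τ₀‖ := by
            gcongr
            exact le_mul_of_one_le_right (norm_nonneg _) (by linarith [norm_nonneg (tauPt τ₀ x)])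
        _ = (‖p.2 - z₀‖ + ‖p.1 - τ₀‖ * τ₀.im⁻¹) * (1 + ‖tauPt τ₀ x‖) := by ring
        _ ≤ _ := by gcongr
    linarith
  have hpos : 0 < ‖p.2 - tauPt p.1 x‖ := lt_of_lt_of_le (by positivity) h1
  refine ⟨norm_pos_iff.mp hpos, ?_⟩
  rw [norm_inv, tauWeight, one_div, ← mul_inv]
  exact inv_anti₀ (by positivity) h1

theorem exists_norm_inv_tauPt_le (hτ₀ : 0 < τ₀.im) :
    ∃ D : ℝ, 0 < D ∧ ∀ᶠ τ : ℂ in 𝓝 τ₀, 0 < τ.im ∧ ∀ x,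
      ‖(tauPt τ x)⁻¹‖ ≤ D * tauWeight τ₀ x := by
  obtain ⟨D, hD, h⟩ := exists_norm_inv_sub_tauPt_le hτ₀ (z₀ := 0) (S := {x | x ≠ 0})
    (fun x hx => tauPt_ne_zero hτ₀ hx)
  refine ⟨D, hD, ?_⟩
  have hc : Tendsto (fun τ : ℂ => (τ, (0 : ℂ))) (𝓝 τ₀) (𝓝 (τ₀, 0)) :=
    (Continuous.prodMk_left (0 : ℂ)).tendsto τ₀
  filter_upwards [hc.eventually h, (Complex.continuous_im.tendsto τ₀).eventually_const_lt hτ₀]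
    with τ hτ him
  refine ⟨him, fun x => ?_⟩
  by_cases hx : x = 0
  · subst hx
    rw [tauPt_zero, inv_zero, norm_zero]
    exact mul_nonneg hD.le (tauWeight_pos _ _).le
  · simpa using (hτ x hx).2

/-- The bounds of `exists_norm_inv_sub_tauPt_le` and `exists_norm_inv_tauPt_le` with a common
constant. -/
theorem exists_norm_inv_le (hτ₀ : 0 < τ₀.im) {z₀ : ℂ} {S : Set (ℤ × ℤ)}
    (hS : ∀ x ∈ S, tauPt τ₀ x ≠ z₀) :
    ∃ D : ℝ, 0 < D ∧ ∀ᶠ p : ℂ × ℂ in 𝓝 (τ₀, z₀), 0 < p.1.im ∧ ∀ x ∈ S,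
      p.2 - tauPt p.1 x ≠ 0 ∧ ‖(p.2 - tauPt p.1 x)⁻¹‖ ≤ D * tauWeight τ₀ x ∧
        ‖(tauPt p.1 x)⁻¹‖ ≤ D * tauWeight τ₀ x := by
  obtain ⟨D, hD, h⟩ := exists_norm_inv_sub_tauPt_le hτ₀ hS
  obtain ⟨D', hD', h'⟩ := exists_norm_inv_tauPt_le hτ₀
  refine ⟨max D D', lt_max_of_lt_left hD, ?_⟩
  filter_upwards [h, (continuous_fst.tendsto (τ₀, z₀)).eventually h'] with p hp hp'
  refine ⟨hp'.1, fun x hx => ⟨(hp x hx).1, (hp x hx).2.trans ?_, (hp'.2 x).trans ?_⟩⟩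
  · exact mul_le_mul_of_nonneg_right (le_max_left _ _) (tauWeight_pos _ _).le
  · exact mul_le_mul_of_nonneg_right (le_max_right _ _) (tauWeight_pos _ _).le

/-- For `l ≠ 0` the summand is `z²/((z - l)l²)`, of cubic decay. The extra `D` in the bound covers
the index 0, where the inverses of `l = 0` vanish by convention and the summand is `1/z`. -/
theorem summable_wzeta {τ : ℂ} (hτ : 0 < τ.im) {z : ℂ} (hz : z ∉ tauLattice τ) :
    Summable fun x => (z - tauPt τ x)⁻¹ + (tauPt τ x)⁻¹ + z * (tauPt τ x)⁻¹ ^ 2 := by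
  obtain ⟨D, hD, h⟩ := exists_norm_inv_le hτ (z₀ := z) (S := Set.univ)
    (fun x _ => tauPt_ne_of_notMem hτ hz x)
  have h := h.self_of_nhds.2
  refine Summable.of_norm_bounded
    ((summable_tauWeight hτ).mul_left (‖z‖ ^ 2 * D ^ 3 + D)) fun x => ?_
  obtain ⟨hne, ha, hb⟩ := h x trivial
  have hw := tauWeight_pos τ x
  by_cases hx : x = 0
  · subst hx
    simp only [tauPt_zero, tauWeight_zero, mul_one, sub_zero] at ha ⊢
    simp only [inv_zero, add_zero, ne_eq, OfNat.ofNat_ne_zero, not_false_eq_true, zero_pow,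
      mul_zero, one_pow, mul_one]
    have : 0 ≤ ‖z‖ ^ 2 * D ^ 3 := by positivity
    linarith
  · have hl := tauPt_ne_zero hτ hx
    have : (z - tauPt τ x)⁻¹ + (tauPt τ x)⁻¹ + z * (tauPt τ x)⁻¹ ^ 2
        = z ^ 2 * ((z - tauPt τ x)⁻¹ * (tauPt τ x)⁻¹ ^ 2) := by
      field_simp
      ring
    rw [this, norm_mul, norm_mul, norm_pow, norm_pow]
    calc ‖z‖ ^ 2 * (‖(z - tauPt τ x)⁻¹‖ * ‖(tauPt τ x)⁻¹‖ ^ 2)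
        ≤ ‖z‖ ^ 2 * ((D * tauWeight τ x) * (D * tauWeight τ x) ^ 2) := by gcongr
      _ = ‖z‖ ^ 2 * D ^ 3 * tauWeight τ x ^ 3 := by ring
      _ ≤ _ := by gcongr; linarith

theorem hasSum_wzeta {τ : ℂ} (hτ : 0 < τ.im) {z : ℂ} (hz : z ∉ tauLattice τ) :
    HasSum (fun x => (z - tauPt τ x)⁻¹ + (tauPt τ x)⁻¹ + z * (tauPt τ x)⁻¹ ^ 2) (wzeta τ z) := by
  have hs := (summable_wzeta hτ hz).hasSum
  have h2 := (hasSum_tauPt_iff hτ (f := fun l => (z - l)⁻¹ + l⁻¹ + z * l⁻¹ ^ 2)).mp hs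
  rw [← h2.tsum_eq] at hs
  convert hs using 1
  rw [wzeta, PeriodPair.weierstrassZeta]
  congr 1
  ext l
  simp [div_eq_mul_inv]

end bounds

/-! ### Continuity and local expansions of ℘, ℘' and ζ -/

variable {τ₀ : ℂ}

/-- Joint continuity of `℘(z | τ)` off the poles. -/
theorem tendsto_wp (hτ₀ : 0 < τ₀.im) {z₀ : ℂ} (hz₀ : z₀ ∉ tauLattice τ₀) :
    Tendsto (fun p : ℂ × ℂ => wp p.1 p.2) (𝓝 (τ₀, z₀)) (𝓝 (wp τ₀ z₀)) := by
  obtain ⟨D, hD, h⟩ := exists_norm_inv_le hτ₀ (z₀ := z₀) (S := Set.univ)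
    (fun x _ => tauPt_ne_of_notMem hτ₀ hz₀ x)
  have hz : ∀ᶠ p : ℂ × ℂ in 𝓝 (τ₀, z₀), ‖p.2‖ < ‖z₀‖ + 1 :=
    (continuous_snd.norm.tendsto (τ₀, z₀)).eventually_lt_const (by simp)
  -- Dominated convergence; in the bound, `D ^ 2` is for the polar summand at index 0, which carries
  -- weight 1, and the other part is for the remaining summands.
  have key := tendsto_tsum_of_dominated_convergence (𝓕 := 𝓝 (τ₀, z₀))
    (f := fun (p : ℂ × ℂ) x => (p.2 - tauPt p.1 x)⁻¹ ^ 2 - (tauPt p.1 x)⁻¹ ^ 2)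
    (g := fun x => (z₀ - tauPt τ₀ x)⁻¹ ^ 2 - (tauPt τ₀ x)⁻¹ ^ 2)
    (bound := fun x => (2 * (‖z₀‖ + 1) * D ^ 3 + D ^ 2) * tauWeight τ₀ x ^ 3)
    ((summable_tauWeight hτ₀).mul_left _) (fun x => ?_) ?_
  · rw [(hasSum_wp hτ₀ z₀).tsum_eq] at key
    refine key.congr' ?_
    filter_upwards [h] with p hp using (hasSum_wp hp.1 p.2).tsum_eq
  · have hc : Continuous fun p : ℂ × ℂ => tauPt p.1 x := by unfold tauPt; fun_prop
    have h1 : Tendsto (fun p : ℂ × ℂ => (p.2 - tauPt p.1 x)⁻¹ ^ 2) (𝓝 (τ₀, z₀))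
        (𝓝 ((z₀ - tauPt τ₀ x)⁻¹ ^ 2)) :=
      (((continuous_snd.sub hc).tendsto (τ₀, z₀)).inv₀
        (h.self_of_nhds.2 x trivial).1).pow 2
    refine h1.sub ?_
    by_cases hx : x = 0
    · subst hx
      simp [tauPt_zero]
    · exact ((hc.tendsto (τ₀, z₀)).inv₀ (tauPt_ne_zero hτ₀ hx)).pow 2
  · filter_upwards [h, hz] with p hp hpz x
    obtain ⟨hne, ha, hb⟩ := hp.2 x trivial
    have hw := tauWeight_pos τ₀ x
    by_cases hx : x = 0
    · subst hx
      simp only [tauPt_zero, tauWeight_zero, mul_one, sub_zero] at ha ⊢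
      simp only [inv_zero, ne_eq, OfNat.ofNat_ne_zero, not_false_eq_true, zero_pow, sub_zero,
        one_pow, mul_one]
      rw [norm_pow]
      have : ‖p.2⁻¹‖ ^ 2 ≤ D ^ 2 := by gcongr
      have : 0 ≤ 2 * (‖z₀‖ + 1) * D ^ 3 := by positivity
      linarith
    · have hl := tauPt_ne_zero hp.1 hx
      have : (p.2 - tauPt p.1 x)⁻¹ ^ 2 - (tauPt p.1 x)⁻¹ ^ 2 = p.2 * ((p.2 - tauPt p.1 x)⁻¹ *
          (tauPt p.1 x)⁻¹ * ((p.2 - tauPt p.1 x)⁻¹ - (tauPt p.1 x)⁻¹)) := by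
        field_simp
        ring
      rw [this, norm_mul, norm_mul, norm_mul]
      set w := tauWeight τ₀ x
      have hab := (norm_sub_le (p.2 - tauPt p.1 x)⁻¹ (tauPt p.1 x)⁻¹).trans (add_le_add ha hb)
      calc ‖p.2‖ * (‖(p.2 - tauPt p.1 x)⁻¹‖ * ‖(tauPt p.1 x)⁻¹‖ *
            ‖(p.2 - tauPt p.1 x)⁻¹ - (tauPt p.1 x)⁻¹‖)
          ≤ (‖z₀‖ + 1) * ((D * w) * (D * w) * (D * w + D * w)) := by gcongr
        _ = 2 * (‖z₀‖ + 1) * D ^ 3 * w ^ 3 := by ring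
        _ ≤ _ := by
          gcongr
          linarith [sq_nonneg D]

theorem norm_le_of_hasSum_tauWeight (hτ₀ : 0 < τ₀.im) {f : ℤ × ℤ → ℂ} {s : ℂ} {K : ℝ}
    (hf : HasSum f s) (h : ∀ x, ‖f x‖ ≤ K * tauWeight τ₀ x ^ 3) :
    ‖s‖ ≤ (∑' x, tauWeight τ₀ x ^ 3) * K := by
  rw [mul_comm]
  exact hf.norm_le_of_bounded ((summable_tauWeight hτ₀).hasSum.mul_left K) h

section summands

variable {z l : ℂ} {r : ℝ}

/-- Geometric series remainder. Here and in the two analogues below, four inverse factors are left,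
so the fourth power of the weight dominates. -/
theorem norm_zeta_summand_le (hz : z - l ≠ 0) (hl : l ≠ 0) (ha : ‖(z - l)⁻¹‖ ≤ r)
    (hb : ‖l⁻¹‖ ≤ r) :
    ‖(z - l)⁻¹ + l⁻¹ + z * l⁻¹ ^ 2 + z ^ 2 * l⁻¹ ^ 3‖ ≤ ‖z‖ ^ 3 * r ^ 4 := by
  have hr : 0 ≤ r := (norm_nonneg _).trans ha
  have e : (z - l)⁻¹ + l⁻¹ + z * l⁻¹ ^ 2 + z ^ 2 * l⁻¹ ^ 3
      = z ^ 3 * ((z - l)⁻¹ * l⁻¹ ^ 3) := by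
    field_simp
    ring
  rw [e, norm_mul, norm_mul, norm_pow, norm_pow]
  calc ‖z‖ ^ 3 * (‖(z - l)⁻¹‖ * ‖l⁻¹‖ ^ 3) ≤ ‖z‖ ^ 3 * (r * r ^ 3) := by gcongr
    _ = _ := by ring

theorem norm_wp_summand_le (hz : z - l ≠ 0) (hl : l ≠ 0) (ha : ‖(z - l)⁻¹‖ ≤ r)
    (hb : ‖l⁻¹‖ ≤ r) :
    ‖(z - l)⁻¹ ^ 2 - l⁻¹ ^ 2 - 2 * z * l⁻¹ ^ 3‖ ≤ ‖z‖ ^ 2 * (3 * r ^ 4) := by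
  have hr : 0 ≤ r := (norm_nonneg _).trans ha
  have e : (z - l)⁻¹ ^ 2 - l⁻¹ ^ 2 - 2 * z * l⁻¹ ^ 3
      = z ^ 2 * ((z - l)⁻¹ * l⁻¹ ^ 2 * ((z - l)⁻¹ - 2 * l⁻¹)) := by
    field_simp
    ring
  have hab : ‖(z - l)⁻¹ - 2 * l⁻¹‖ ≤ 3 * r := by
    refine (norm_sub_le _ _).trans ?_
    rw [norm_mul, Complex.norm_ofNat]
    linarith
  rw [e, norm_mul, norm_mul, norm_mul, norm_pow, norm_pow]
  calc ‖z‖ ^ 2 * (‖(z - l)⁻¹‖ * ‖l⁻¹‖ ^ 2 * ‖(z - l)⁻¹ - 2 * l⁻¹‖)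
      ≤ ‖z‖ ^ 2 * (r * r ^ 2 * (3 * r)) := by gcongr
    _ = _ := by ring

theorem norm_wpDeriv_summand_le (hz : z - l ≠ 0) (hl : l ≠ 0) (ha : ‖(z - l)⁻¹‖ ≤ r)
    (hb : ‖l⁻¹‖ ≤ r) :
    ‖-2 * (z - l)⁻¹ ^ 3 - 2 * l⁻¹ ^ 3‖ ≤ ‖z‖ * (6 * r ^ 4) := by
  have hr : 0 ≤ r := (norm_nonneg _).trans ha
  have e : -2 * (z - l)⁻¹ ^ 3 - 2 * l⁻¹ ^ 3 = z * (-2 * ((z - l)⁻¹ * l⁻¹ *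
      ((z - l)⁻¹ ^ 2 - (z - l)⁻¹ * l⁻¹ + l⁻¹ ^ 2))) := by
    field_simp
    ring
  have hab : ‖(z - l)⁻¹ ^ 2 - (z - l)⁻¹ * l⁻¹ + l⁻¹ ^ 2‖ ≤ 3 * r ^ 2 := by
    refine (norm_add_le _ _).trans ((add_le_add_left (norm_sub_le _ _) _).trans ?_)
    rw [norm_pow, norm_pow, norm_mul]
    calc _ ≤ r ^ 2 + r * r + r ^ 2 := by gcongr
      _ = _ := by ring
  rw [e, norm_mul, norm_mul, norm_mul, norm_mul, norm_neg, Complex.norm_ofNat]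
  calc ‖z‖ * (2 * (‖(z - l)⁻¹‖ * ‖l⁻¹‖ * ‖(z - l)⁻¹ ^ 2 - (z - l)⁻¹ * l⁻¹ + l⁻¹ ^ 2‖))
      ≤ ‖z‖ * (2 * (r * r * (3 * r ^ 2))) := by gcongr
    _ = _ := by ring

end summands

/-- The leading terms of `ζ`, `℘`, `℘'` at `z = 0`, locally uniformly in `τ`. -/
theorem exists_norm_sub_principal_part_le (hτ₀ : 0 < τ₀.im) :
    ∃ C : ℝ, 0 < C ∧ ∀ᶠ p : ℂ × ℂ in 𝓝 (τ₀, 0), p.2 ≠ 0 →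
      ‖wzeta p.1 p.2 - p.2⁻¹‖ ≤ C * ‖p.2‖ ^ 3 ∧ ‖wp p.1 p.2 - p.2⁻¹ ^ 2‖ ≤ C * ‖p.2‖ ^ 2 ∧
        ‖wpDeriv p.1 p.2 + 2 * p.2⁻¹ ^ 3‖ ≤ C * ‖p.2‖ := by
  obtain ⟨D, hD, h⟩ := exists_norm_inv_le hτ₀ (z₀ := 0) (S := {x | x ≠ 0})
    (fun x hx => tauPt_ne_zero hτ₀ hx)
  set T := ∑' x, tauWeight τ₀ x ^ 3 with hT
  have hT0 : 0 ≤ T := tsum_nonneg fun x => (pow_pos (tauWeight_pos τ₀ x) 3).le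
  refine ⟨T * (6 * D ^ 4) + 1, by positivity, ?_⟩
  filter_upwards [h] with p hp hz
  obtain ⟨τ, z⟩ := p
  obtain ⟨him, hp⟩ := hp
  simp only at him hp hz ⊢
  have hzΛ : z ∉ tauLattice τ := by
    rw [mem_tauLattice him]
    rintro ⟨x, rfl⟩
    by_cases hx : x = 0
    · subst hx
      exact hz (tauPt_zero τ)
    · exact (hp x hx).1 (sub_self _)
  -- This gains one order in each remainder. For ζ it yields `O(z³)`, and thus `2pζ(2p) = 1 +
  -- O(p⁴)`, the `O(q²)` needed in the equation for `q`.
  have h0 := hasSum_tauPt_inv_pow_three him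
  have hpole : ∀ c : ℂ, HasSum (fun x : ℤ × ℤ => if x = 0 then c else 0) c := fun c =>
    hasSum_ite_eq 0 c
  -- it suffices to bound the summands with `x ≠ 0` once the principal part is subtracted
  have hfin : ∀ {f : ℤ × ℤ → ℂ} {s c : ℂ} {N K : ℝ}, HasSum f s → 0 ≤ N → 0 ≤ K → K ≤ 6 →
      f 0 = c → (∀ x ≠ 0, ‖f x‖ ≤ N * (K * (D * tauWeight τ₀ x) ^ 4)) →
      ‖s - c‖ ≤ (T * (6 * D ^ 4) + 1) * N := by
    intro f s c N K hf hN hK0 hK h0 hb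
    have h1 := norm_le_of_hasSum_tauWeight hτ₀ (K := N * (6 * D ^ 4)) (hf.sub (hpole c))
      fun x => ?_
    · refine h1.trans ?_
      linarith
    by_cases hx : x = 0
    · subst hx
      rw [if_pos rfl, h0, sub_self, norm_zero]
      exact mul_nonneg (by positivity) (pow_pos (tauWeight_pos τ₀ 0) 3).le
    rw [if_neg hx, sub_zero]
    have hw := tauWeight_pos τ₀ x
    calc ‖f x‖ ≤ N * (K * (D * tauWeight τ₀ x) ^ 4) := hb x hx
      _ ≤ N * (6 * (D * tauWeight τ₀ x) ^ 4) := by gcongr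
      _ = N * (6 * D ^ 4) * tauWeight τ₀ x ^ 4 := by ring
      _ ≤ _ := mul_le_mul_of_nonneg_left
        (pow_le_pow_of_le_one hw.le (tauWeight_le_one τ₀ x) (by norm_num)) (by positivity)
  refine ⟨?_, ?_, ?_⟩
  · have hs := (hasSum_wzeta him hzΛ).add (h0.mul_left (z ^ 2))
    rw [mul_zero, add_zero] at hs
    refine hfin (K := 1) hs (by positivity) (by norm_num) (by norm_num) ?_ fun x hx => ?_
    · simp [tauPt_zero]
    · rw [one_mul]
      exact norm_zeta_summand_le (hp x hx).1 (tauPt_ne_zero him hx) (hp x hx).2.1 (hp x hx).2.2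
  · have hs := (hasSum_wp him z).sub (h0.mul_left (2 * z))
    rw [mul_zero, sub_zero] at hs
    refine hfin (K := 3) hs (by positivity) (by norm_num) (by norm_num) ?_ fun x hx => ?_
    · simp [tauPt_zero]
    · exact norm_wp_summand_le (hp x hx).1 (tauPt_ne_zero him hx) (hp x hx).2.1 (hp x hx).2.2
  · have hs := (hasSum_wpDeriv him z).sub (h0.mul_left 2)
    rw [mul_zero, sub_zero] at hs
    have := hfin (K := 6) (c := -2 * z⁻¹ ^ 3) hs (norm_nonneg z) (by norm_num) le_rfl ?_
      fun x hx => ?_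
    · rwa [neg_mul, sub_neg_eq_add] at this
    · simp [tauPt_zero]
    · exact norm_wpDeriv_summand_le (hp x hx).1 (tauPt_ne_zero him hx) (hp x hx).2.1
        (hp x hx).2.2

section halfPeriods

theorem omega_mem_tauLattice {τ : ℂ} (hτ : 0 < τ.im) (k : Fin 4) : omega τ k ∈ tauLattice τ := by
  rw [mem_tauLattice hτ]
  fin_cases k
  · exact ⟨(0, 0), by simp [tauPt, omega]⟩
  · exact ⟨(1, 0), by simp [tauPt, omega]⟩
  · exact ⟨(0, 1), by simp [tauPt, omega]⟩
  · exact ⟨(1, 1), by simp [tauPt, omega]⟩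

theorem omega_succ_div_two_notMem {τ : ℂ} (hτ : 0 < τ.im) (j : Fin 3) :
    omega τ j.succ / 2 ∉ tauLattice τ := by
  set P := tauPair (UpperHalfPlane.ofComplex τ) with hP
  have h1 : P.ω₁ = 1 := rfl
  have h2 : P.ω₂ = τ := tauPair_ω₂ hτ
  fin_cases j
  · have := P.ω₁_div_two_notMem_lattice
    rw [h1] at this
    exact this
  · have := P.ω₂_div_two_notMem_lattice
    rw [h2] at this
    exact this
  · have := (P.mul_ω₁_add_mul_ω₂_mem_lattice (α := 1 / 2) (β := 1 / 2)).not.mpr (by norm_num)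
    rw [h1, h2] at this
    intro h
    refine this ?_
    convert! h using 1
    simp [omega]
    ring

/-- ℘' is odd and periodic, and `ω/2` and `-ω/2` differ by a period. -/
theorem wpDeriv_half_omega {τ : ℂ} (hτ : 0 < τ.im) (k : Fin 4) :
    wpDeriv τ (omega τ k / 2) = 0 := by
  set P := tauPair (UpperHalfPlane.ofComplex τ) with hP
  have h1 := P.derivWeierstrassP_sub_coe (omega τ k / 2) ⟨omega τ k, omega_mem_tauLattice hτ k⟩
  have h2 : omega τ k / 2 - omega τ k = -(omega τ k / 2) := by ring
  rw [h2, P.derivWeierstrassP_neg] at h1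
  exact self_eq_neg.mp h1.symm

theorem continuous_omega (k : Fin 4) : Continuous fun τ => omega τ k := by
  fin_cases k <;> simp [omega] <;> fun_prop

/-- Since ℘' vanishes at `ω/2`, its series there may be subtracted termwise, and each difference
carries a factor `z`. Thus `p ℘'(p + ω/2)` is `O(q)`. -/
theorem exists_norm_wpDeriv_add_half_omega_le (hτ₀ : 0 < τ₀.im) (j : Fin 3) :
    ∃ C : ℝ, 0 < C ∧ ∀ᶠ p : ℂ × ℂ in 𝓝 (τ₀, 0),
      ‖wpDeriv p.1 (p.2 + omega p.1 j.succ / 2)‖ ≤ C * ‖p.2‖ := by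
  obtain ⟨D, hD, h⟩ := exists_norm_inv_le hτ₀ (z₀ := omega τ₀ j.succ / 2) (S := Set.univ)
    (fun x _ => tauPt_ne_of_notMem hτ₀ (omega_succ_div_two_notMem hτ₀ j) x)
  set T := ∑' x, tauWeight τ₀ x ^ 3 with hT
  have hT0 : 0 ≤ T := tsum_nonneg fun x => (pow_pos (tauWeight_pos τ₀ x) 3).le
  have hω := continuous_omega j.succ
  have c1 : Tendsto (fun p : ℂ × ℂ => (p.1, p.2 + omega p.1 j.succ / 2)) (𝓝 (τ₀, 0))
      (𝓝 (τ₀, omega τ₀ j.succ / 2)) := by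
    have : Continuous (fun p : ℂ × ℂ => (p.1, p.2 + omega p.1 j.succ / 2)) := by fun_prop
    simpa using this.tendsto (τ₀, 0)
  have c2 : Tendsto (fun p : ℂ × ℂ => (p.1, omega p.1 j.succ / 2)) (𝓝 (τ₀, 0))
      (𝓝 (τ₀, omega τ₀ j.succ / 2)) := by
    have : Continuous (fun p : ℂ × ℂ => (p.1, omega p.1 j.succ / 2)) := by fun_prop
    simpa using this.tendsto (τ₀, 0)
  refine ⟨T * (6 * D ^ 4) + 1, by positivity, ?_⟩
  filter_upwards [c1.eventually h, c2.eventually h] with p h1 h2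
  obtain ⟨τ, z⟩ := p
  obtain ⟨him, h1⟩ := h1
  obtain ⟨-, h2⟩ := h2
  simp only at him h1 h2 ⊢
  set e := omega τ j.succ / 2 with he
  have hs := (hasSum_wpDeriv him (z + e)).sub (hasSum_wpDeriv him e)
  rw [he, wpDeriv_half_omega him, sub_zero, ← he] at hs
  have := norm_le_of_hasSum_tauWeight hτ₀ (K := ‖z‖ * (6 * D ^ 4)) hs fun x => ?_
  · refine this.trans ?_
    linarith [norm_nonneg z]
  · obtain ⟨hne, ha, -⟩ := h1 x trivial
    obtain ⟨hne', ha', -⟩ := h2 x trivial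
    have hw := (tauWeight_pos τ₀ x).le
    set a := (z + e - tauPt τ x)⁻¹ with hadef
    set b := (e - tauPt τ x)⁻¹ with hbdef
    have hab : a - b = -z * (a * b) := by
      rw [hadef, hbdef]
      field_simp
      ring
    have heq : -2 * a ^ 3 - -2 * b ^ 3 = z * (2 * (a * b * (a ^ 2 + a * b + b ^ 2))) := by
      linear_combination (-2 * (a ^ 2 + a * b + b ^ 2)) * hab
    have hq : ‖a ^ 2 + a * b + b ^ 2‖ ≤ 3 * (D * tauWeight τ₀ x) ^ 2 := by
      refine (norm_add_le _ _).trans ((add_le_add_left (norm_add_le _ _) _).trans ?_)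
      rw [norm_pow, norm_pow, norm_mul]
      calc _ ≤ (D * tauWeight τ₀ x) ^ 2 + (D * tauWeight τ₀ x) * (D * tauWeight τ₀ x) +
            (D * tauWeight τ₀ x) ^ 2 := by gcongr
        _ = _ := by ring
    rw [heq, norm_mul, norm_mul, norm_mul, norm_mul, Complex.norm_ofNat]
    calc ‖z‖ * (2 * (‖a‖ * ‖b‖ * ‖a ^ 2 + a * b + b ^ 2‖))
        ≤ ‖z‖ * (2 * ((D * tauWeight τ₀ x) * (D * tauWeight τ₀ x) *
          (3 * (D * tauWeight τ₀ x) ^ 2))) := by gcongr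
      _ = ‖z‖ * (6 * D ^ 4) * tauWeight τ₀ x ^ 4 := by ring
      _ ≤ _ := mul_le_mul_of_nonneg_left (pow_le_pow_of_le_one hw (tauWeight_le_one τ₀ x)
        (by norm_num)) (by positivity)

end halfPeriods

/-- The symmetric difference of `ζ` is `-2 u ℘` up to third order, locally uniformly. -/
theorem exists_norm_wzeta_sub_le (hτ₀ : 0 < τ₀.im) {z₀ : ℂ} (hz₀ : z₀ ∉ tauLattice τ₀) :
    ∃ C : ℝ, 0 < C ∧ ∀ᶠ p : (ℂ × ℂ) × ℂ in 𝓝 ((τ₀, z₀), 0),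
      ‖wzeta p.1.1 (p.1.2 + p.2) - wzeta p.1.1 (p.1.2 - p.2) + 2 * p.2 * wp p.1.1 p.1.2‖
        ≤ C * ‖p.2‖ ^ 3 := by
  obtain ⟨D, hD, h⟩ := exists_norm_inv_le hτ₀ (z₀ := z₀) (S := Set.univ)
    (fun x _ => tauPt_ne_of_notMem hτ₀ hz₀ x)
  set T := ∑' x, tauWeight τ₀ x ^ 3 with hT
  have hT0 : 0 ≤ T := tsum_nonneg fun x => (pow_pos (tauWeight_pos τ₀ x) 3).le
  have c1 : Tendsto (fun p : (ℂ × ℂ) × ℂ => (p.1.1, p.1.2 + p.2)) (𝓝 ((τ₀, z₀), 0))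
      (𝓝 (τ₀, z₀)) := by
    have : Continuous (fun p : (ℂ × ℂ) × ℂ => (p.1.1, p.1.2 + p.2)) := by fun_prop
    simpa using this.tendsto ((τ₀, z₀), 0)
  have c2 : Tendsto (fun p : (ℂ × ℂ) × ℂ => (p.1.1, p.1.2 - p.2)) (𝓝 ((τ₀, z₀), 0))
      (𝓝 (τ₀, z₀)) := by
    have : Continuous (fun p : (ℂ × ℂ) × ℂ => (p.1.1, p.1.2 - p.2)) := by fun_prop
    simpa using this.tendsto ((τ₀, z₀), 0)
  refine ⟨T * (2 * D ^ 4) + 1, by positivity, ?_⟩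
  filter_upwards [c1.eventually h, c2.eventually h,
    (continuous_fst.tendsto ((τ₀, z₀), (0 : ℂ))).eventually h] with p h1 h2 h3
  obtain ⟨⟨τ, z⟩, u⟩ := p
  obtain ⟨him, h1⟩ := h1
  obtain ⟨-, h2⟩ := h2
  obtain ⟨-, h3⟩ := h3
  simp only at him h1 h2 h3 ⊢
  have hmem : ∀ v, (∀ x ∈ Set.univ, v - tauPt τ x ≠ 0 ∧
      ‖(v - tauPt τ x)⁻¹‖ ≤ D * tauWeight τ₀ x ∧ ‖(tauPt τ x)⁻¹‖ ≤ D * tauWeight τ₀ x) →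
      v ∉ tauLattice τ := by
    intro v hv hmem
    obtain ⟨x, rfl⟩ := (mem_tauLattice him).mp hmem
    exact (hv x trivial).1 (sub_self _)
  have hs := ((hasSum_wzeta him (hmem _ h1)).sub (hasSum_wzeta him (hmem _ h2))).add
    ((hasSum_wp him z).mul_left (2 * u))
  have := norm_le_of_hasSum_tauWeight hτ₀ (K := ‖u‖ ^ 3 * (2 * D ^ 4)) hs fun x => ?_
  · refine this.trans ?_
    have : 0 ≤ ‖u‖ ^ 3 := by positivity
    linarith
  · obtain ⟨hne1, ha1, -⟩ := h1 x trivial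
    obtain ⟨hne2, ha2, -⟩ := h2 x trivial
    obtain ⟨hne3, ha3, -⟩ := h3 x trivial
    have hw := (tauWeight_pos τ₀ x).le
    -- The terms in `l⁻²` cancel. With `a = z - l` the rest is `1/(a+u) - 1/(a-u) + 2u/a² =
    -- -2u³/(a²(a² - u²))`.
    have heq : (z + u - tauPt τ x)⁻¹ + (tauPt τ x)⁻¹ + (z + u) * (tauPt τ x)⁻¹ ^ 2 -
        ((z - u - tauPt τ x)⁻¹ + (tauPt τ x)⁻¹ + (z - u) * (tauPt τ x)⁻¹ ^ 2) +
        2 * u * ((z - tauPt τ x)⁻¹ ^ 2 - (tauPt τ x)⁻¹ ^ 2)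
        = u ^ 3 * (-2 * ((z - tauPt τ x)⁻¹ ^ 2 *
          ((z + u - tauPt τ x)⁻¹ * (z - u - tauPt τ x)⁻¹))) := by
      have : (z + u - tauPt τ x)⁻¹ - (z - u - tauPt τ x)⁻¹ + 2 * u * (z - tauPt τ x)⁻¹ ^ 2
        = u ^ 3 * (-2 * ((z - tauPt τ x)⁻¹ ^ 2 *
          ((z + u - tauPt τ x)⁻¹ * (z - u - tauPt τ x)⁻¹))) := by
        field_simp
        ring
      rw [← this]
      ring
    rw [heq, norm_mul, norm_mul, norm_mul, norm_mul, norm_neg, Complex.norm_ofNat, norm_pow,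
      norm_pow]
    calc ‖u‖ ^ 3 * (2 * (‖(z - tauPt τ x)⁻¹‖ ^ 2 *
          (‖(z + u - tauPt τ x)⁻¹‖ * ‖(z - u - tauPt τ x)⁻¹‖)))
        ≤ ‖u‖ ^ 3 * (2 * ((D * tauWeight τ₀ x) ^ 2 *
          ((D * tauWeight τ₀ x) * (D * tauWeight τ₀ x)))) := by gcongr
      _ = ‖u‖ ^ 3 * (2 * D ^ 4) * tauWeight τ₀ x ^ 4 := by ring
      _ ≤ _ := mul_le_mul_of_nonneg_left (pow_le_pow_of_le_one hw (tauWeight_le_one τ₀ x)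
        (by norm_num)) (by positivity)

/-- Varying τ costs a factor `|n|` per summand but yields four inverse factors; one of them absorbs
`|n|` and the other three are summable. -/
theorem wzeta_sub_isBigO (hτ₀ : 0 < τ₀.im) {z : ℂ} (hz : z ∉ tauLattice τ₀) :
    (fun τ => wzeta τ z - wzeta τ₀ z) =O[𝓝 τ₀] fun τ => τ - τ₀ := by
  obtain ⟨D, hD, h⟩ := exists_norm_inv_le hτ₀ (z₀ := z) (S := Set.univ)
    (fun x _ => tauPt_ne_of_notMem hτ₀ hz x)
  have h0 := h.self_of_nhds.2
  have hc : Tendsto (fun τ : ℂ => (τ, z)) (𝓝 τ₀) (𝓝 (τ₀, z)) :=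
    (Continuous.prodMk_left z).tendsto τ₀
  set T := ∑' x, tauWeight τ₀ x ^ 3 with hT
  refine IsBigO.of_bound (T * (3 * ‖z‖ ^ 2 * D ^ 4 * τ₀.im⁻¹)) ?_
  filter_upwards [hc.eventually h] with τ hp
  obtain ⟨him, h1⟩ := hp
  simp only at him h1 h0
  have hzτ : z ∉ tauLattice τ := by
    intro hmem
    obtain ⟨x, rfl⟩ := (mem_tauLattice him).mp hmem
    exact (h1 x trivial).1 (sub_self _)
  have hs := (hasSum_wzeta him hzτ).sub (hasSum_wzeta hτ₀ hz)
  have hκ : 0 < τ₀.im⁻¹ := inv_pos.mpr hτ₀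
  rw [mul_assoc]
  refine norm_le_of_hasSum_tauWeight hτ₀ hs fun x => ?_
  have hw := (tauWeight_pos τ₀ x).le
  by_cases hx : x = 0
  · subst hx
    simp only [tauPt_zero, sub_self, norm_zero]
    positivity
  obtain ⟨hne1, ha1, hb1⟩ := h1 x trivial
  obtain ⟨hne0, ha0, hb0⟩ := h0 x trivial
  have hl1 := tauPt_ne_zero him hx
  have hl0 := tauPt_ne_zero hτ₀ hx
  have hdiff := tauPt_sub_tauPt τ τ₀ x
  set l := tauPt τ x
  set l₀ := tauPt τ₀ x
  set a := (z - l)⁻¹ with ha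
  set a₀ := (z - l₀)⁻¹ with ha₀
  set b := l⁻¹ with hb
  set b₀ := l₀⁻¹ with hb₀
  set r := D * tauWeight τ₀ x with hr
  have hr0 : 0 ≤ r := by positivity
  have heq : a + b + z * b ^ 2 - (a₀ + b₀ + z * b₀ ^ 2)
      = z ^ 2 * ((l - l₀) * (a * a₀ * b ^ 2 - a₀ * (b * b₀) * (b + b₀))) := by
    rw [ha, ha₀, hb, hb₀]
    field_simp
    ring
  have hbr : ‖a * a₀ * b ^ 2 - a₀ * (b * b₀) * (b + b₀)‖ ≤ 3 * r ^ 4 := by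
    refine (norm_sub_le _ _).trans ?_
    simp only [norm_mul, norm_pow]
    calc _ ≤ r * r * r ^ 2 + r * (r * r) * (r + r) := by
          gcongr
          exact (norm_add_le _ _).trans (add_le_add hb1 hb0)
      _ = _ := by ring
  rw [heq, hdiff, norm_mul, norm_mul, norm_mul, norm_pow]
  calc ‖z‖ ^ 2 * (‖(x.2 : ℂ)‖ * ‖τ - τ₀‖ * ‖a * a₀ * b ^ 2 - a₀ * (b * b₀) * (b + b₀)‖)
      ≤ ‖z‖ ^ 2 * (‖(x.2 : ℂ)‖ * ‖τ - τ₀‖ * (3 * r ^ 4)) := by gcongr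
    _ = (‖(x.2 : ℂ)‖ * tauWeight τ₀ x) *
        (3 * ‖z‖ ^ 2 * D ^ 4 * ‖τ - τ₀‖ * tauWeight τ₀ x ^ 3) := by rw [hr]; ring
    _ ≤ τ₀.im⁻¹ * (3 * ‖z‖ ^ 2 * D ^ 4 * ‖τ - τ₀‖ * tauWeight τ₀ x ^ 3) :=
      mul_le_mul_of_nonneg_right (norm_int_mul_tauWeight_le hτ₀ x) (by positivity)
    _ = _ := by ring

theorem eta1_sub_isBigO (hτ₀ : 0 < τ₀.im) :
    (fun τ => eta1 τ - eta1 τ₀) =O[𝓝 τ₀] fun τ => τ - τ₀ := by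
  have h1 : (1 / 2 : ℂ) ∉ tauLattice τ₀ := by
    simpa [omega] using omega_succ_div_two_notMem hτ₀ 0
  have h2 : (-1 / 2 : ℂ) ∉ tauLattice τ₀ := by
    intro h
    have := (tauPair (UpperHalfPlane.ofComplex τ₀)).lattice.neg_mem h
    rw [neg_div, neg_neg] at this
    exact h1 this
  refine ((wzeta_sub_isBigO hτ₀ h1).sub (wzeta_sub_isBigO hτ₀ h2)).congr_left fun τ => ?_
  rw [eta1, eta1]
  ring

/-! ### Reduction of the Hamiltonian system to the model system -/

section reduction

variable {τ₀ : ℂ} {U : Set ℂ} {n : Fin 4 → ℂ} {p A : ℂ → ℂ}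

theorem IsHamiltonianSolution.ne_zero (hpA : IsHamiltonianSolution n p A U) {τ : ℂ} (hτ : τ ∈ U) :
    p τ ≠ 0 := by
  intro h
  refine hpA.two_mul_notMem τ hτ ?_
  rw [h, mul_zero]
  exact zero_mem_tauLattice τ

/-- Continuity would force `p τ₀ = 0`, a lattice point. This permits division by `τ - τ₀` on `U`. -/
theorem IsHamiltonianSolution.notMem (hpA : IsHamiltonianSolution n p A U)
    (hp : Tendsto p (𝓝[U] τ₀) (𝓝 0)) : τ₀ ∉ U := by
  intro h
  have h1 : Tendsto p (𝓝[U] τ₀) (𝓝 (p τ₀)) :=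
    (hpA.hasDerivAt_p τ₀ h).continuousAt.continuousWithinAt
  have := (mem_closure_iff_nhdsWithin_neBot.mp (subset_closure h))
  exact hpA.ne_zero h (tendsto_nhds_unique h1 hp)

/-- Along a solution with `p → 0`, the elliptic functions in the Hamiltonian system agree with
their principal parts, up to terms of the order of their next Taylor coefficient. -/
theorem exists_remainder_bounds (hτ₀ : 0 < τ₀.im) (hp0 : ∀ τ ∈ U, p τ ≠ 0)
    (hp : Tendsto p (𝓝[U] τ₀) (𝓝 0)) (N : Fin 4 → ℂ) :
    ∃ C : ℝ, 0 < C ∧ ∀ᶠ τ in 𝓝[U] τ₀,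
      ‖wzeta τ (2 * p τ) - (2 * p τ)⁻¹‖ ≤ C * ‖p τ‖ ^ 3 ∧
      ‖wp τ (2 * p τ) - (2 * p τ)⁻¹ ^ 2‖ ≤ C * ‖p τ‖ ^ 2 ∧
      ‖wp τ (p τ) - (p τ)⁻¹ ^ 2‖ ≤ C * ‖p τ‖ ^ 2 ∧
      ‖wpDeriv τ (2 * p τ) + 2 * (2 * p τ)⁻¹ ^ 3‖ ≤ C * ‖p τ‖ ∧
      ‖∑ k, N k * wpDeriv τ (p τ + omega τ k / 2) + 2 * N 0 * (p τ)⁻¹ ^ 3‖ ≤ C * ‖p τ‖ := by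
  obtain ⟨C, hC, h⟩ := exists_norm_sub_principal_part_le hτ₀
  choose C' hC' h' using fun j : Fin 3 => exists_norm_wpDeriv_add_half_omega_le hτ₀ j
  have hid : Tendsto (fun τ : ℂ => τ) (𝓝[U] τ₀) (𝓝 τ₀) := tendsto_id.mono_left nhdsWithin_le_nhds
  have t1 : Tendsto (fun τ => (τ, p τ)) (𝓝[U] τ₀) (𝓝 (τ₀, 0)) := hid.prodMk_nhds hp
  have t2 : Tendsto (fun τ => (τ, 2 * p τ)) (𝓝[U] τ₀) (𝓝 (τ₀, 0)) :=
    hid.prodMk_nhds (by simpa using hp.const_mul 2)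
  have h3 : ∀ᶠ τ in 𝓝[U] τ₀, ∀ j : Fin 3,
      ‖wpDeriv τ (p τ + omega τ j.succ / 2)‖ ≤ C' j * ‖p τ‖ :=
    eventually_all.mpr fun j => t1.eventually (h' j)
  set S := ∑ j : Fin 3, ‖N j.succ‖ * C' j with hS
  have hS0 : 0 ≤ S := Finset.sum_nonneg fun j _ => mul_nonneg (norm_nonneg _) (hC' j).le
  refine ⟨8 * C + ‖N 0‖ * C + S, by positivity, ?_⟩
  filter_upwards [self_mem_nhdsWithin, t1.eventually h, t2.eventually h, h3] with τ hτ e1 e2 e3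
  have hne := hp0 τ hτ
  obtain ⟨-, a2, a3⟩ := e1 hne
  obtain ⟨b1, b2, b3⟩ := e2 (mul_ne_zero two_ne_zero hne)
  simp only [norm_mul, Complex.norm_ofNat] at a2 a3 b1 b2 b3
  have hx := norm_nonneg (p τ)
  have hNC : 0 ≤ ‖N 0‖ * C := by positivity
  refine ⟨b1.trans ?_, b2.trans ?_, a2.trans ?_, b3.trans ?_, ?_⟩
  · nlinarith [pow_nonneg hx 3]
  · nlinarith [pow_nonneg hx 2]
  · nlinarith [pow_nonneg hx 2]
  · nlinarith
  rw [Fin.sum_univ_succ]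
  have hω : omega τ 0 = 0 := rfl
  rw [hω, zero_div, add_zero]
  calc ‖N 0 * wpDeriv τ (p τ) + ∑ j : Fin 3, N j.succ * wpDeriv τ (p τ + omega τ j.succ / 2) +
        2 * N 0 * (p τ)⁻¹ ^ 3‖
      = ‖N 0 * (wpDeriv τ (p τ) + 2 * (p τ)⁻¹ ^ 3) +
        ∑ j : Fin 3, N j.succ * wpDeriv τ (p τ + omega τ j.succ / 2)‖ := by ring_nf
    _ ≤ ‖N 0‖ * (C * ‖p τ‖) + ∑ j : Fin 3, ‖N j.succ‖ * (C' j * ‖p τ‖) := by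
      refine (norm_add_le _ _).trans (add_le_add ?_ ((norm_sum_le _ _).trans ?_))
      · rw [norm_mul]
        gcongr
      · refine Finset.sum_le_sum fun j _ => ?_
        rw [norm_mul]
        exact mul_le_mul_of_nonneg_left (e3 j) (norm_nonneg _)
    _ = (‖N 0‖ * C + S) * ‖p τ‖ := by
      rw [hS, add_mul, Finset.sum_mul]
      simp only [mul_assoc]
    _ ≤ _ := by
      gcongr
      linarith

/-- The behaviour of `p²`, `p A` and `((p A - 1/4)² - (n₀ + 1/2)²) / p²` along a solution of the
Hamiltonian system with `p → 0`. -/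
theorem IsHamiltonianSolution.exists_expansion (hτ₀ : 0 < τ₀.im) (hU : IsBranchDomain τ₀ U)
    (hpA : IsHamiltonianSolution n p A U) (hp : Tendsto p (𝓝[U] τ₀) (𝓝 0)) {α : ℂ}
    (hα : α = -Complex.I / (4 * Real.pi)) :
    ∃ L H₀ : ℂ, L ^ 2 = (n 0 + 1 / 2) ^ 2 ∧
      Tendsto (fun τ => p τ * A τ) (𝓝[U] τ₀) (𝓝 (1 / 4 + L)) ∧
      Tendsto (fun τ => ((p τ * A τ - 1 / 4) ^ 2 - (n 0 + 1 / 2) ^ 2) / p τ ^ 2)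
        (𝓝[U] τ₀) (𝓝 H₀) ∧
      (fun τ => p τ ^ 2 - 4 * α * L * (τ - τ₀) -
        (4 * α ^ 2 * H₀ + 8 * α ^ 2 * eta1 τ₀ * L) * (τ - τ₀) ^ 2)
        =O[𝓝[U] τ₀] fun τ => (τ - τ₀) ^ 3 := by
  set N : Fin 4 → ℂ := fun k => n k * (n k + 1) with hN
  obtain ⟨C, hC, hrem⟩ := exists_remainder_bounds hτ₀ (fun τ hτ => hpA.ne_zero hτ) hp N
  obtain ⟨c, hc⟩ := (eta1_sub_isBigO hτ₀).bound
  have hp1 : ∀ᶠ τ in 𝓝[U] τ₀, ‖p τ‖ < 1 := hp.norm.eventually_lt_const (by simp)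
  have hall := (hrem.and hp1).and (nhdsWithin_le_nhds hc : ∀ᶠ τ in 𝓝[U] τ₀, _)
  obtain ⟨ε, hε, hεV⟩ := Metric.mem_nhdsWithin_iff.mp hall
  rw [Set.inter_comm] at hεV
  have hV : U ∩ Metric.ball τ₀ ε ∈ 𝓝[U] τ₀ :=
    inter_mem self_mem_nhdsWithin (mem_nhdsWithin_of_mem_nhds (Metric.ball_mem_nhds τ₀ hε))
  -- `Eq` and `Ew` collect the remainders after the principal parts. In `(pA)'` the terms with `η₁`
  -- cancel, and the polar terms give `2(w² - w/2 - 3/16 - n₀(n₀+1))/p² = 2H`, because `n₀(n₀+1) +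
  -- 1/4 = (n₀+1/2)²`.
  have key := hU.exists_expansion hε (α := α) (ν := n 0 + 1 / 2) (η₀ := eta1 τ₀)
    (q := fun τ => p τ ^ 2) (w := fun τ => p τ * A τ)
    (H := fun τ => ((p τ * A τ - 1 / 4) ^ 2 - (n 0 + 1 / 2) ^ 2) / p τ ^ 2) (η := eta1)
    (Eq := fun τ => -2 * (p τ * (wzeta τ (2 * p τ) - (2 * p τ)⁻¹)))
    (Ew := fun τ => -A τ * (wzeta τ (2 * p τ) - (2 * p τ)⁻¹)
      - 2 * (p τ * A τ) * (wp τ (2 * p τ) - (2 * p τ)⁻¹ ^ 2)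
      + 3 / 2 * (p τ * (wpDeriv τ (2 * p τ) + 2 * (2 * p τ)⁻¹ ^ 3))
      + p τ * (∑ k, N k * wpDeriv τ (p τ + omega τ k / 2) + 2 * N 0 * (p τ)⁻¹ ^ 3))
    ?_ ?_ ?_ ?_ ?_ ?_ ?_ ?_ ?_
  · obtain ⟨L, H₀, h1, h2, h3, h4⟩ := key
    exact ⟨L, H₀, h1, h2, h3, h4.mono (le_principal_iff.mpr hV)⟩
  · intro τ hτ
    have hne := hpA.ne_zero hτ.1
    have h1 := (hpA.hasDerivAt_p τ hτ.1).pow 2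
    refine h1.congr_deriv ?_
    rw [← hα]
    push_cast
    field_simp
    ring
  · intro τ hτ
    have hne := hpA.ne_zero hτ.1
    have h1 := (hpA.hasDerivAt_p τ hτ.1).mul (hpA.hasDerivAt_A τ hτ.1)
    refine h1.congr_deriv ?_
    have hα' : Complex.I / (4 * Real.pi) = -α := by rw [hα]; ring
    rw [← hα, hα']
    simp only [hN]
    generalize wzeta τ (2 * p τ) = x1
    generalize wp τ (2 * p τ) = x2
    generalize wpDeriv τ (2 * p τ) = x3
    generalize ∑ k, n k * (n k + 1) * wpDeriv τ (p τ + omega τ k / 2) = x4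
    field_simp
    ring
  · refine isBigO_principal.mpr ⟨2 * C, fun τ hτ => ?_⟩
    obtain ⟨⟨⟨e1, -⟩, -⟩, -⟩ := hεV hτ
    rw [norm_mul, norm_mul, norm_neg, Complex.norm_ofNat, norm_pow, norm_pow]
    nlinarith [mul_le_mul_of_nonneg_left e1 (norm_nonneg (p τ))]
  · refine isBigO_principal.mpr ⟨6 * C, fun τ hτ => ?_⟩
    obtain ⟨⟨⟨e1, e2, -, e3, e4⟩, -⟩, -⟩ := hεV hτ
    have hx := norm_nonneg (p τ)
    have hA := norm_nonneg (A τ)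
    have a1 : ‖-A τ * (wzeta τ (2 * p τ) - (2 * p τ)⁻¹)‖ ≤ C * ‖p τ‖ ^ 2 * (‖p τ‖ * ‖A τ‖) := by
      rw [norm_mul, norm_neg]
      nlinarith [mul_le_mul_of_nonneg_left e1 hA]
    have a2 : ‖2 * (p τ * A τ) * (wp τ (2 * p τ) - (2 * p τ)⁻¹ ^ 2)‖
        ≤ 2 * C * ‖p τ‖ ^ 2 * (‖p τ‖ * ‖A τ‖) := by
      rw [norm_mul, norm_mul, norm_mul, Complex.norm_ofNat]
      nlinarith [mul_le_mul_of_nonneg_left e2 (mul_nonneg hx hA)]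
    have a3 : ‖3 / 2 * (p τ * (wpDeriv τ (2 * p τ) + 2 * (2 * p τ)⁻¹ ^ 3))‖
        ≤ 2 * C * ‖p τ‖ ^ 2 := by
      rw [norm_mul, norm_mul, show ‖(3 / 2 : ℂ)‖ = 3 / 2 by norm_num]
      nlinarith [mul_le_mul_of_nonneg_left e3 hx, mul_nonneg hC.le (sq_nonneg ‖p τ‖)]
    have a4 : ‖p τ * (∑ k, N k * wpDeriv τ (p τ + omega τ k / 2) + 2 * N 0 * (p τ)⁻¹ ^ 3)‖
        ≤ C * ‖p τ‖ ^ 2 := by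
      rw [norm_mul]
      nlinarith [mul_le_mul_of_nonneg_left e4 hx]
    have a5 := (norm_sub_le (-A τ * (wzeta τ (2 * p τ) - (2 * p τ)⁻¹))
      (2 * (p τ * A τ) * (wp τ (2 * p τ) - (2 * p τ)⁻¹ ^ 2))).trans (add_le_add a1 a2)
    refine (norm_add_le _ _).trans
      ((add_le_add ((norm_add_le _ _).trans (add_le_add a5 a3)) a4).trans ?_)
    rw [Real.norm_of_nonneg (by positivity), norm_pow, norm_mul]
    have hCp : 0 ≤ C * ‖p τ‖ ^ 2 := by positivity
    nlinarith [mul_nonneg hCp (mul_nonneg hx hA)]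
  · intro τ hτ
    have := hpA.ne_zero hτ.1
    field_simp
    ring
  · exact fun τ hτ => pow_ne_zero 2 (hpA.ne_zero hτ.1)
  · intro τ hτ
    obtain ⟨⟨-, e1⟩, -⟩ := hεV hτ
    rw [norm_pow]
    exact pow_le_one₀ (norm_nonneg _) e1.le
  · exact isBigO_principal.mpr ⟨c, fun τ hτ => (hεV hτ).2⟩
  · simpa using hp.pow 2

end reduction

/-! ### The square root at the vertex -/

section branch

variable {τ₀ : ℂ} {U : Set ℂ}

/-- If `p² = c₀² (τ - τ₀) (1 + 2 h (τ - τ₀) + O((τ - τ₀)²))` at the vertex of a branch domain, then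
`p = c₀ (τ - τ₀)^{1/2} (1 + h (τ - τ₀) + O((τ - τ₀)²))` for a suitable branch of the root. -/
theorem IsBranchDomain.exists_sqrt (hU : IsBranchDomain τ₀ U) (hτ₀ : τ₀ ∉ U) {p : ℂ → ℂ}
    (hpc : ContinuousOn p U) {c₀ h : ℂ} (hc₀ : c₀ ≠ 0)
    (hO : (fun τ => p τ ^ 2 - c₀ ^ 2 * ((τ - τ₀) + 2 * h * (τ - τ₀) ^ 2)) =O[𝓝[U] τ₀]
      fun τ => (τ - τ₀) ^ 3) :
    ∃ s R : ℂ → ℂ, (DifferentiableOn ℂ s U ∧ ∀ τ ∈ U, s τ ^ 2 = τ - τ₀) ∧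
      (∀ τ ∈ U, p τ = c₀ * s τ * (1 + h * (τ - τ₀) + R τ)) ∧
      R =O[𝓝[U] τ₀] fun τ => (τ - τ₀) ^ 2 := by
  have hd : ∀ τ ∈ U, τ - τ₀ ≠ 0 := fun τ hτ => sub_ne_zero.mpr fun h => hτ₀ (h ▸ hτ)
  have hdlim : Tendsto (fun τ : ℂ => τ - τ₀) (𝓝[U] τ₀) (𝓝 0) := by
    have : Continuous (fun τ : ℂ => τ - τ₀) := by fun_prop
    simpa using (this.tendsto τ₀).mono_left nhdsWithin_le_nhds
  set g : ℂ → ℂ := fun τ => p τ ^ 2 / (c₀ ^ 2 * (τ - τ₀)) with hg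
  have hgO : (fun τ => g τ - 1 - 2 * h * (τ - τ₀)) =O[𝓝[U] τ₀] fun τ => (τ - τ₀) ^ 2 := by
    have := (hO.mul (isBigO_refl (fun τ => (τ - τ₀)⁻¹) (𝓝[U] τ₀))).const_mul_left (c₀ ^ 2)⁻¹
    refine this.congr' ?_ ?_
    · filter_upwards [self_mem_nhdsWithin] with τ hτ
      have := hd τ hτ
      simp only [hg]
      field_simp
      ring
    · filter_upwards [self_mem_nhdsWithin] with τ hτ
      have := hd τ hτ
      field_simp
  have hglim : Tendsto g (𝓝[U] τ₀) (𝓝 1) := by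
    have h1 : Tendsto (fun τ => g τ - 1 - 2 * h * (τ - τ₀)) (𝓝[U] τ₀) (𝓝 0) :=
      hgO.trans_tendsto (by simpa using hdlim.pow 2)
    have h2 := (h1.add (hdlim.const_mul (2 * h))).add_const 1
    simpa using h2
  -- Near the vertex `g` is close to 1, so its principal root is continuous there. Then `p/(c₀σ)` is
  -- a root of `τ - τ₀`, with the sign dictated by `p` itself.
  set σ : ℂ → ℂ := fun τ => g τ ^ (1 / 2 : ℂ) with hσ
  have hσ2 : ∀ τ, σ τ ^ 2 = g τ := by
    intro τ
    simp [hσ]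
  have hσlim : Tendsto σ (𝓝[U] τ₀) (𝓝 1) := by
    have h1 : ContinuousAt (fun z : ℂ => z ^ (1 / 2 : ℂ)) 1 :=
      continuousAt_cpow_const (by simp)
    have h2 : Tendsto σ (𝓝[U] τ₀) (𝓝 ((1 : ℂ) ^ (1 / 2 : ℂ))) := h1.tendsto.comp hglim
    rwa [Complex.one_cpow] at h2
  have hslit : ∀ᶠ τ in 𝓝[U] τ₀, g τ ∈ Complex.slitPlane :=
    hglim.eventually_mem (Complex.isOpen_slitPlane.mem_nhds (by simp))
  obtain ⟨ε, hε, hεV⟩ := Metric.mem_nhdsWithin_iff.mp hslit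
  rw [Set.inter_comm] at hεV
  set V := U ∩ Metric.ball τ₀ ε with hV
  have hσ0 : ∀ τ ∈ V, σ τ ≠ 0 := by
    intro τ hτ h0
    have h1 := hσ2 τ
    rw [h0, zero_pow two_ne_zero] at h1
    exact Complex.slitPlane_ne_zero (hεV hτ) h1.symm
  have hσc : ContinuousOn σ V := by
    refine ContinuousOn.cpow_const ?_ fun τ hτ => hεV hτ
    refine ((hpc.mono Set.inter_subset_left).pow 2).div (by fun_prop) fun τ hτ => ?_
    exact mul_ne_zero (pow_ne_zero 2 hc₀) (hd τ hτ.1)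
  set s₁ : ℂ → ℂ := fun τ => p τ / (c₀ * σ τ) with hs₁
  have hs₁c : ContinuousOn s₁ V :=
    (hpc.mono Set.inter_subset_left).div (hσc.const_mul c₀)
      fun τ hτ => mul_ne_zero hc₀ (hσ0 τ hτ)
  have hs₁2 : ∀ τ ∈ V, s₁ τ ^ 2 = τ - τ₀ := by
    intro τ hτ
    have h0 := hd τ hτ.1
    have h1 : p τ ^ 2 = g τ * (c₀ ^ 2 * (τ - τ₀)) := by
      simp only [hg]
      field_simp
    have h2 := Complex.slitPlane_ne_zero (hεV hτ)
    simp only [hs₁, div_pow, mul_pow, hσ2, h1]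
    field_simp
  -- extend the local branch to `U` by scaling towards the vertex
  set r : ℂ → ℝ := fun τ => min 1 (ε / (2 * ‖τ - τ₀‖)) with hr
  have hr0 : ∀ τ ∈ U, 0 < r τ := fun τ hτ =>
    lt_min one_pos (div_pos hε (mul_pos two_pos (norm_pos_iff.mpr (hd τ hτ))))
  have hr1 : ∀ τ, r τ ≤ 1 := fun τ => min_le_left _ _
  have hrc : ContinuousOn r U := by
    refine ContinuousOn.inf continuousOn_const (continuousOn_const.div (by fun_prop) fun τ hτ => ?_)
    exact mul_ne_zero two_ne_zero (norm_ne_zero_iff.mpr (hd τ hτ))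
  have hmaps : Set.MapsTo (fun τ => τ₀ + (r τ : ℂ) * (τ - τ₀)) U V := by
    intro τ hτ
    refine ⟨hU.segment_mem τ hτ _ (hr0 τ hτ) (hr1 τ), ?_⟩
    have hn := norm_pos_iff.mpr (hd τ hτ)
    rw [mem_ball_iff_norm, add_sub_cancel_left, norm_mul, Complex.norm_real,
      Real.norm_of_nonneg (hr0 τ hτ).le]
    calc r τ * ‖τ - τ₀‖ ≤ ε / (2 * ‖τ - τ₀‖) * ‖τ - τ₀‖ := by
          gcongr
          exact min_le_right _ _
      _ = ε / 2 := by field_simp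
      _ < ε := by linarith
  have hrcC : ContinuousOn (fun τ => (r τ : ℂ)) U := Complex.continuous_ofReal.comp_continuousOn hrc
  set s : ℂ → ℂ := fun τ => s₁ (τ₀ + (r τ : ℂ) * (τ - τ₀)) / (Real.sqrt (r τ) : ℂ) with hs
  have hsqrt0 : ∀ τ ∈ U, (Real.sqrt (r τ) : ℂ) ≠ 0 := fun τ hτ =>
    Complex.ofReal_ne_zero.mpr (Real.sqrt_pos.mpr (hr0 τ hτ)).ne'
  have hs2 : ∀ τ ∈ U, s τ ^ 2 = τ - τ₀ := by
    intro τ hτ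
    have h1 : (Real.sqrt (r τ) : ℂ) ^ 2 = (r τ : ℂ) := by
      rw [← Complex.ofReal_pow, Real.sq_sqrt (hr0 τ hτ).le]
    have h2 : (r τ : ℂ) ≠ 0 := Complex.ofReal_ne_zero.mpr (hr0 τ hτ).ne'
    simp only [hs, div_pow, h1]
    rw [hs₁2 _ (hmaps hτ), add_sub_cancel_left, mul_div_cancel_left₀ _ h2]
  have hsc : ContinuousOn s U := by
    refine ContinuousOn.div (hs₁c.comp (continuousOn_const.add (hrcC.mul (by fun_prop))) hmaps)
      ?_ hsqrt0
    exact Complex.continuous_ofReal.comp_continuousOn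
      (Real.continuous_sqrt.comp_continuousOn hrc)
  have hs0 : ∀ τ ∈ U, s τ ≠ 0 := by
    intro τ hτ h0
    have := hs2 τ hτ
    rw [h0, zero_pow two_ne_zero] at this
    exact hd τ hτ this.symm
  -- A continuous right inverse of `z ↦ z² + τ₀`, whose derivative `2s` does not vanish, is
  -- holomorphic.
  have hsd : DifferentiableOn ℂ s U := by
    intro τ hτ
    have h1 : HasDerivAt (fun z : ℂ => z ^ 2 + τ₀) (2 * s τ) (s τ) := by
      simpa using (hasDerivAt_pow 2 (s τ)).add_const τ₀
    refine (HasDerivAt.of_local_left_inverse (hsc.continuousAt (hU.isOpen.mem_nhds hτ)) h1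
      (mul_ne_zero two_ne_zero (hs0 τ hτ)) ?_).differentiableAt.differentiableWithinAt
    filter_upwards [hU.isOpen.mem_nhds hτ] with t ht
    rw [hs2 t ht, sub_add_cancel]
  refine ⟨s, fun τ => p τ / (c₀ * s τ) - 1 - h * (τ - τ₀), ⟨hsd, hs2⟩, fun τ hτ => ?_, ?_⟩
  · have := hs0 τ hτ
    field_simp
    ring
  -- With `t = τ - τ₀`, this numerator is `g - (1 + ht)² = (σ - 1 - ht)(σ + 1 + ht)`, and the second
  -- factor tends to 2.
  have hnum : (fun τ => (g τ - 1 - 2 * h * (τ - τ₀)) - h ^ 2 * (τ - τ₀) ^ 2) =O[𝓝[U] τ₀]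
      fun τ => (τ - τ₀) ^ 2 := hgO.sub ((isBigO_refl _ _).const_mul_left _)
  have hden : Tendsto (fun τ => σ τ + 1 + h * (τ - τ₀)) (𝓝[U] τ₀) (𝓝 2) := by
    have := (hσlim.add_const 1).add (hdlim.const_mul h)
    rw [show (1 : ℂ) + 1 + h * 0 = 2 by norm_num] at this
    exact this
  have hinv := (hden.inv₀ two_ne_zero).isBigO_one ℂ
  have hprod := hnum.mul hinv
  simp only [mul_one] at hprod
  refine hprod.congr' ?_ EventuallyEq.rfl
  have hball : Metric.ball τ₀ (ε / 2) ∈ 𝓝[U] τ₀ :=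
    mem_nhdsWithin_of_mem_nhds (Metric.ball_mem_nhds τ₀ (by positivity))
  filter_upwards [self_mem_nhdsWithin, hball, hden.eventually_ne two_ne_zero] with τ hτ hτb hne
  have hn := norm_pos_iff.mpr (hd τ hτ)
  rw [mem_ball_iff_norm] at hτb
  have hτV : τ ∈ V := ⟨hτ, by rw [mem_ball_iff_norm]; linarith⟩
  have hr1' : r τ = 1 := by
    refine min_eq_left ?_
    rw [le_div_iff₀ (by positivity)]
    linarith
  have hss : s τ = s₁ τ := by simp [hs, hr1']
  have hp0 : p τ ≠ 0 := by
    intro h0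
    have h1 := hs0 τ hτ
    rw [hss] at h1
    exact h1 (by simp [hs₁, h0])
  have hquot : p τ / (c₀ * s τ) = σ τ := by
    have := hσ0 τ hτV
    rw [hss]
    simp only [hs₁]
    field_simp
  rw [hquot, ← hσ2 τ, ← div_eq_mul_inv, div_eq_iff hne]
  ring

end branch

/-! ### Convergence of the potential -/

section potential

variable {τ₀ : ℂ} {U : Set ℂ} {n : Fin 4 → ℂ} {p A : ℂ → ℂ} {L H₀ : ℂ}

/-- The principal parts `A² - A/(2p) - 3/(16p²) - n₀(n₀+1)/p²` equal exactly the quotient with limit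
`H₀`. The remainders tend to 0, as `pA` is bounded. -/
theorem tendsto_apparentB (hτ₀ : 0 < τ₀.im) (hp0 : ∀ τ ∈ U, p τ ≠ 0)
    (hp : Tendsto p (𝓝[U] τ₀) (𝓝 0))
    (hw : Tendsto (fun τ => p τ * A τ) (𝓝[U] τ₀) (𝓝 (1 / 4 + L)))
    (hH : Tendsto (fun τ => ((p τ * A τ - 1 / 4) ^ 2 - (n 0 + 1 / 2) ^ 2) / p τ ^ 2)
        (𝓝[U] τ₀) (𝓝 H₀)) :
    Tendsto (fun τ => apparentB n τ (p τ) (A τ)) (𝓝[U] τ₀)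
      (𝓝 (H₀ - ∑ j : Fin 3, n j.succ * (n j.succ + 1) * wp τ₀ (omega τ₀ j.succ / 2))) := by
  obtain ⟨C, hC, hrem⟩ := exists_remainder_bounds hτ₀ hp0 hp (fun _ => 0)
  have hid : Tendsto (fun τ : ℂ => τ) (𝓝[U] τ₀) (𝓝 τ₀) := tendsto_id.mono_left nhdsWithin_le_nhds
  have hpn : Tendsto (fun τ => ‖p τ‖) (𝓝[U] τ₀) (𝓝 0) := by simpa using hp.norm
  have hp2 : Tendsto (fun τ => C * ‖p τ‖ ^ 2) (𝓝[U] τ₀) (𝓝 0) := by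
    simpa using (hpn.pow 2).const_mul C
  have r1 : Tendsto (fun τ => A τ * (wzeta τ (2 * p τ) - (2 * p τ)⁻¹)) (𝓝[U] τ₀) (𝓝 0) := by
    have hlim : Tendsto (fun τ => ‖p τ * A τ‖ * (C * ‖p τ‖ ^ 2)) (𝓝[U] τ₀) (𝓝 0) := by
      simpa using hw.norm.mul hp2
    refine squeeze_zero_norm' ?_ hlim
    filter_upwards [hrem] with τ hτ
    rw [norm_mul, norm_mul]
    nlinarith [mul_le_mul_of_nonneg_left hτ.1 (norm_nonneg (A τ))]
  have r2 : Tendsto (fun τ => wp τ (2 * p τ) - (2 * p τ)⁻¹ ^ 2) (𝓝[U] τ₀) (𝓝 0) :=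
    squeeze_zero_norm' (hrem.mono fun τ hτ => hτ.2.1) hp2
  have r3 : Tendsto (fun τ => wp τ (p τ) - (p τ)⁻¹ ^ 2) (𝓝[U] τ₀) (𝓝 0) :=
    squeeze_zero_norm' (hrem.mono fun τ hτ => hτ.2.2.1) hp2
  have r4 : Tendsto (fun τ => ∑ j : Fin 3, n j.succ * (n j.succ + 1) *
      wp τ (p τ + omega τ j.succ / 2)) (𝓝[U] τ₀)
      (𝓝 (∑ j : Fin 3, n j.succ * (n j.succ + 1) * wp τ₀ (omega τ₀ j.succ / 2))) := by
    refine tendsto_finsetSum _ fun j _ => Tendsto.const_mul _ ?_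
    refine (tendsto_wp hτ₀ (omega_succ_div_two_notMem hτ₀ j)).comp
      (f := fun τ => (τ, p τ + omega τ j.succ / 2)) (hid.prodMk_nhds ?_)
    have := hp.add ((((continuous_omega j.succ).tendsto τ₀).comp hid).div_const 2)
    simpa using this
  have h := (((hH.sub r1).sub (r2.const_mul (3 / 4))).sub (r3.const_mul (n 0 * (n 0 + 1)))).sub r4
  simp only [mul_zero, sub_zero] at h
  refine h.congr' ?_
  filter_upwards [self_mem_nhdsWithin] with τ hτ
  have hne := hp0 τ hτ
  have hω : omega τ 0 = 0 := rfl
  rw [apparentB, Fin.sum_univ_succ (n := 3), hω, zero_div, add_zero]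
  generalize ∑ j : Fin 3, n j.succ * (n j.succ + 1) * wp τ (p τ + omega τ j.succ / 2) = x1
  field_simp
  ring

/-- Joint convergence in parameter and variable, with continuity of the limit, gives local
uniformity by the triangle inequality; no compactness is needed. -/
theorem tendstoLocallyUniformlyOn_of_tendsto {α β E : Type*} [TopologicalSpace α]
    [PseudoMetricSpace E] {F : β → α → E} {f : α → E} {l : Filter β} {s : Set α}
    (hf : ContinuousOn f s)
    (h : ∀ x ∈ s, Tendsto (fun y : β × α => F y.1 y.2) (l ×ˢ 𝓝[s] x) (𝓝 (f x))) :
    TendstoLocallyUniformlyOn F f l s := by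
  rw [tendstoLocallyUniformlyOn_iff_filter]
  intro x hx u hu
  have h1 : Tendsto (fun y : β × α => f y.2) (l ×ˢ 𝓝[s] x) (𝓝 (f x)) :=
    (hf x hx).tendsto.comp tendsto_snd
  exact (h1.prodMk_nhds (h x hx)) (nhds_le_uniformity _ hu)

theorem notMem_tauLattice_of_notMem_singularPoints {z : ℂ} (hz : z ∉ singularPoints n τ₀) :
    z ∉ tauLattice τ₀ := fun h => hz (Or.inl h)

/-- A term of the potential with a pole at a half period, in which the coefficient may vanish. -/
theorem tendsto_coeff_mul_wp (hτ₀ : 0 < τ₀.im) {z₀ : ℂ} (hz₀ : z₀ ∉ singularPoints n τ₀)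
    (j : Fin 3) {ι : Type*} {F : Filter ι} {t z : ι → ℂ} (ht : Tendsto t F (𝓝 τ₀))
    (hz : Tendsto z F (𝓝 z₀)) :
    Tendsto (fun i => n j.succ * (n j.succ + 1) * wp (t i) (z i + omega (t i) j.succ / 2)) F
      (𝓝 (n j.succ * (n j.succ + 1) * wp τ₀ (z₀ + omega τ₀ j.succ / 2))) := by
  by_cases hN : n j.succ * (n j.succ + 1) = 0
  · simp only [hN, zero_mul]
    exact tendsto_const_nhds
  have hmem : z₀ + omega τ₀ j.succ / 2 ∉ tauLattice τ₀ := fun h => hz₀ (Or.inr ⟨j, hN, h⟩)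
  refine Tendsto.const_mul _ ((tendsto_wp hτ₀ hmem).comp
    (f := fun i => (t i, z i + omega (t i) j.succ / 2)) (ht.prodMk_nhds (hz.add ?_)))
  exact (((continuous_omega j.succ).tendsto τ₀).comp ht).div_const 2

theorem continuousOn_limitPotential (hτ₀ : 0 < τ₀.im) (m B : ℂ) :
    ContinuousOn (limitPotential n m B τ₀) (singularPoints n τ₀)ᶜ := by
  intro z₀ hz₀
  have hid : Tendsto (fun z : ℂ => z) (𝓝[(singularPoints n τ₀)ᶜ] z₀) (𝓝 z₀) :=
    tendsto_id.mono_left nhdsWithin_le_nhds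
  refine Tendsto.add (Tendsto.add ?_ (Tendsto.const_mul _ ?_)) tendsto_const_nhds
  · exact tendsto_finsetSum _ fun j _ =>
      tendsto_coeff_mul_wp hτ₀ hz₀ j tendsto_const_nhds hid
  · exact (tendsto_wp hτ₀ (notMem_tauLattice_of_notMem_singularPoints hz₀)).comp
      (f := fun z => (τ₀, z)) (tendsto_const_nhds.prodMk_nhds hid)

/-- The condition on `m` collects the coefficients of `℘(z)`: `n₀(n₀+1)` from the pole at 0, `3/2`
from the two merging poles `±p`, and `-2 lim pA` from the difference of ζ. -/
theorem tendsto_genLamePotential (hτ₀ : 0 < τ₀.im)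
    (hp : Tendsto p (𝓝[U] τ₀) (𝓝 0))
    (hw : Tendsto (fun τ => p τ * A τ) (𝓝[U] τ₀) (𝓝 (1 / 4 + L))) {b : ℂ → ℂ} {B₀ m : ℂ}
    (hb : Tendsto b (𝓝[U] τ₀) (𝓝 B₀))
    (hm : m * (m + 1) = n 0 * (n 0 + 1) + 3 / 2 - 2 * (1 / 4 + L)) {z₀ : ℂ}
    (hz₀ : z₀ ∉ singularPoints n τ₀) :
    Tendsto (fun y : ℂ × ℂ => genLamePotential n y.1 (p y.1) (A y.1) (b y.1) y.2)
      (𝓝[U] τ₀ ×ˢ 𝓝 z₀) (𝓝 (limitPotential n m B₀ τ₀ z₀)) := by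
  have hzΛ := notMem_tauLattice_of_notMem_singularPoints hz₀
  set F := 𝓝[U] τ₀ ×ˢ 𝓝 z₀ with hF
  have ht : Tendsto (fun y : ℂ × ℂ => y.1) F (𝓝 τ₀) := tendsto_fst.mono_right nhdsWithin_le_nhds
  have ht' : Tendsto (fun y : ℂ × ℂ => y.1) F (𝓝[U] τ₀) := tendsto_fst
  have hz : Tendsto (fun y : ℂ × ℂ => y.2) F (𝓝 z₀) := tendsto_snd
  have hpF : Tendsto (fun y : ℂ × ℂ => p y.1) F (𝓝 0) := hp.comp ht'
  have hwF : Tendsto (fun y : ℂ × ℂ => p y.1 * A y.1) F (𝓝 (1 / 4 + L)) := hw.comp ht'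
  have hwp : ∀ f : ℂ × ℂ → ℂ, Tendsto f F (𝓝 z₀) →
      Tendsto (fun y : ℂ × ℂ => wp y.1 (f y)) F (𝓝 (wp τ₀ z₀)) := fun f hf =>
    (tendsto_wp hτ₀ hzΛ).comp (f := fun y : ℂ × ℂ => (y.1, f y)) (ht.prodMk_nhds hf)
  have h0 := (hwp _ hz).const_mul (n 0 * (n 0 + 1))
  have h1 : Tendsto (fun y : ℂ × ℂ => ∑ j : Fin 3, n j.succ * (n j.succ + 1) *
      wp y.1 (y.2 + omega y.1 j.succ / 2)) F
      (𝓝 (∑ j : Fin 3, n j.succ * (n j.succ + 1) * wp τ₀ (z₀ + omega τ₀ j.succ / 2))) :=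
    tendsto_finsetSum _ fun j _ => tendsto_coeff_mul_wp hτ₀ hz₀ j ht hz
  have h2 := ((hwp (fun y => y.2 + p y.1) (by simpa using hz.add hpF)).add
    (hwp (fun y => y.2 - p y.1) (by simpa using hz.sub hpF))).const_mul (3 / 4)
  have h3 : Tendsto (fun y : ℂ × ℂ => A y.1 * (wzeta y.1 (y.2 + p y.1) - wzeta y.1 (y.2 - p y.1)
      + 2 * p y.1 * wp y.1 y.2)) F (𝓝 0) := by
    obtain ⟨C, hC, hev⟩ := exists_norm_wzeta_sub_le hτ₀ hzΛ
    have hlim : Tendsto (fun y : ℂ × ℂ => ‖p y.1 * A y.1‖ * (C * ‖p y.1‖ ^ 2)) F (𝓝 0) := by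
      simpa using hwF.norm.mul ((hpF.norm.pow 2).const_mul C)
    refine squeeze_zero_norm' ?_ hlim
    have hc : Tendsto (fun y : ℂ × ℂ => (y, p y.1)) F (𝓝 ((τ₀, z₀), 0)) :=
      (ht.prodMk_nhds hz).prodMk_nhds hpF
    filter_upwards [hc.eventually hev] with y hy
    rw [norm_mul, norm_mul]
    calc ‖A y.1‖ * _ ≤ ‖A y.1‖ * (C * ‖p y.1‖ ^ 3) :=
          mul_le_mul_of_nonneg_left hy (norm_nonneg _)
      _ = _ := by ring
  have h4 := (hwF.mul (hwp _ hz)).const_mul 2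
  have h5 : Tendsto (fun y : ℂ × ℂ => b y.1) F (𝓝 B₀) := hb.comp ht'
  have h := ((((h0.add h1).add h2).add h3).sub h4).add h5
  have hval : n 0 * (n 0 + 1) * wp τ₀ z₀ + ∑ j : Fin 3, n j.succ * (n j.succ + 1) *
      wp τ₀ (z₀ + omega τ₀ j.succ / 2) + 3 / 4 * (wp τ₀ z₀ + wp τ₀ z₀) + 0
      - 2 * ((1 / 4 + L) * wp τ₀ z₀) + B₀ = limitPotential n m B₀ τ₀ z₀ := by
    rw [limitPotential, hm]
    ring
  rw [hval] at h
  refine h.congr fun y => ?_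
  have hω : omega y.1 0 = 0 := rfl
  rw [genLamePotential, Fin.sum_univ_succ (n := 3), hω, zero_div, add_zero]
  ring

end potential

/-! ### Assembly of the theorem -/

theorem theorem3p2 (n : Fin 4 → ℂ)
    (hn : ∀ k : Fin 4, ∀ j : ℤ, n k ≠ 1 / 2 + (j : ℂ))
    (τ₀ : ℂ) (hτ₀ : 0 < τ₀.im) (U : Set ℂ) (hU : IsBranchDomain τ₀ U)
    (p A : ℂ → ℂ) (hpA : IsHamiltonianSolution n p A U)
    (hp : Tendsto p (𝓝[U] τ₀) (𝓝 0)) :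
    ∃ c₀ h m B₀ : ℂ, ∃ s R : ℂ → ℂ,
      (DifferentiableOn ℂ s U ∧ ∀ τ ∈ U, s τ ^ 2 = τ - τ₀) ∧
      (∀ τ ∈ U, p τ = c₀ * s τ * (1 + h * (τ - τ₀) + R τ)) ∧
      R =O[𝓝[U] τ₀] (fun τ => (τ - τ₀) ^ 2) ∧
      ((c₀ ^ 2 = Complex.I * (n 0 + 1 / 2) / Real.pi ∧ m = n 0 + 1) ∨
        (c₀ ^ 2 = -Complex.I * (n 0 + 1 / 2) / Real.pi ∧ m = n 0 - 1)) ∧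
      B₀ = 2 * Real.pi * Complex.I * c₀ ^ 2 * (4 * Real.pi * Complex.I * h - eta1 τ₀)
        - ∑ j : Fin 3, n j.succ * (n j.succ + 1) * wp τ₀ (omega τ₀ j.succ / 2) ∧
      TendstoLocallyUniformlyOn
        (fun τ z => genLamePotential n τ (p τ) (A τ) (apparentB n τ (p τ) (A τ)) z)
        (limitPotential n m B₀ τ₀) (𝓝[U] τ₀) (singularPoints n τ₀)ᶜ := by
  -- Excluding `n₀ = -1/2` is what keeps `L`, and hence `c₀`, nonzero.
  have hν : n 0 + 1 / 2 ≠ 0 := by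
    intro h0
    refine hn 0 (-1) ?_
    push_cast
    linear_combination h0
  have hπ : (Real.pi : ℂ) ≠ 0 := Complex.ofReal_ne_zero.mpr Real.pi_ne_zero
  have hp0 : ∀ τ ∈ U, p τ ≠ 0 := fun τ hτ => hpA.ne_zero hτ
  obtain ⟨L, H₀, hL, hw, hH, hexp⟩ := hpA.exists_expansion hτ₀ hU hp rfl
  have hL0 : L ≠ 0 := by
    rintro rfl
    exact hν (pow_eq_zero_iff two_ne_zero |>.mp (hL.symm.trans (zero_pow two_ne_zero)))
  -- Either square root of `4αL = -iL/π` will do; the branch `s` is chosen afterwards to match the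
  -- sign.
  obtain ⟨c₀, hc⟩ := IsAlgClosed.exists_pow_nat_eq (-Complex.I * L / Real.pi) (n := 2) two_pos
  have hc2 : c₀ ^ 2 ≠ 0 := by
    rw [hc]
    exact div_ne_zero (mul_ne_zero (neg_ne_zero.mpr Complex.I_ne_zero) hL0) hπ
  have hc₀ : c₀ ≠ 0 := fun h0 => hc2 (by rw [h0, zero_pow two_ne_zero])
  set α : ℂ := -Complex.I / (4 * Real.pi) with hα
  have hα2 : α ^ 2 = -1 / (16 * Real.pi ^ 2) := by
    rw [hα, div_pow, neg_sq, Complex.I_sq]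
    ring
  have hcα : 4 * α * L = c₀ ^ 2 := by
    rw [hc, hα]
    field_simp
  set h : ℂ := (4 * α ^ 2 * H₀ + 8 * α ^ 2 * eta1 τ₀ * L) / (2 * c₀ ^ 2) with hh
  have hh2 : c₀ ^ 2 * (2 * h) = 4 * α ^ 2 * H₀ + 8 * α ^ 2 * eta1 τ₀ * L := by
    rw [hh]
    field_simp
  clear_value h
  -- The quadratic coefficient is solved for `H₀`, using `16π²α² = -1` and `πi c₀² = L`.
  have hH₀ : H₀ = 2 * Real.pi * Complex.I * c₀ ^ 2 * (4 * Real.pi * Complex.I * h - eta1 τ₀) := by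
    have e1 : -16 * (Real.pi : ℂ) ^ 2 * α ^ 2 = 1 := by
      rw [hα2]
      field_simp
    have e3 : 4 * Real.pi * (c₀ ^ 2 * h) * Real.pi * 2 = -H₀ + -2 * eta1 τ₀ * L := by
      linear_combination (4 * (Real.pi : ℂ) ^ 2) * hh2 - (H₀ + 2 * eta1 τ₀ * L) * e1
    have e4 : Real.pi * Complex.I * c₀ ^ 2 = L := by
      rw [hc]
      field_simp
      linear_combination (-1 : ℂ) * Complex.I_sq
    linear_combination e3 + 2 * eta1 τ₀ * e4
      - (8 * Real.pi ^ 2 * c₀ ^ 2 * h) * Complex.I_sq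
  have hcont : ContinuousOn p U := fun τ hτ =>
    (hpA.hasDerivAt_p τ hτ).continuousAt.continuousWithinAt
  obtain ⟨s, R, hs, hpR, hR⟩ := hU.exists_sqrt (hpA.notMem hp) hcont hc₀ (h := h)
    (hexp.congr_left fun τ => by rw [← hh2, hcα]; ring)
  obtain ⟨m, hm, hcm⟩ : ∃ m : ℂ, m * (m + 1) = n 0 * (n 0 + 1) + 3 / 2 - 2 * (1 / 4 + L) ∧
      ((c₀ ^ 2 = Complex.I * (n 0 + 1 / 2) / Real.pi ∧ m = n 0 + 1) ∨
        (c₀ ^ 2 = -Complex.I * (n 0 + 1 / 2) / Real.pi ∧ m = n 0 - 1)) := by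
    -- The sign flips: because `c₀² = -iL/π`, the root `L = n₀ + 1/2` belongs to the second
    -- alternative and its negative to the first.
    rcases sq_eq_sq_iff_eq_or_eq_neg.mp hL with hL | hL
    · exact ⟨n 0 - 1, by rw [hL]; ring, Or.inr ⟨by rw [hc, hL], rfl⟩⟩
    · exact ⟨n 0 + 1, by rw [hL]; ring, Or.inl ⟨by rw [hc, hL]; ring, rfl⟩⟩
  have hB := tendsto_apparentB hτ₀ hp0 hp hw hH
  refine ⟨c₀, h, m, _, s, R, hs, hpR, hR, hcm, by rw [← hH₀], ?_⟩
  refine tendstoLocallyUniformlyOn_of_tendsto (continuousOn_limitPotential hτ₀ m _)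
    fun z₀ hz₀ => ?_
  exact (tendsto_genLamePotential hτ₀ hp hw hB hm hz₀).mono_left
    (prod_mono_right _ nhdsWithin_le_nhds)
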